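/- Let $0<q<1$. **Algebras and coaction.** Let $\mathcal{O}(SU_q(2))$ be the unital complex $*$-algebra generated by $\alpha,\gamma$ with the relations saying that $$T^{(1)}=\begin{pmatrix}\alpha&-q\gamma^*\\ \gamma&\alpha^*\end{pmatrix}$$ is unitary. Let $\mathcal{O}(S^7_q)$ be the unital complex $*$-algebra generated by $x_1,\dots,x_4$ with the relations $$x_1x_2=qx_2x_1,\quad x_1x_3=qx_3x_1,\quad x_1x_4=q^2x_4x_1,\quad x_2x_3=q^2x_3x_2+q^2(q-q^{-1})x_4x_1,\quad x_2x_4=qx_4x_2,\quad x_3x_4=qx_4x_3,$$ $$x_1^*x_1=x_1x_1^*,\quad x_1^*x_2=qx_2x_1^*,\quad x_1^*x_3=qx_3x_1^*,\quad x_1^*x_4=q^2x_4x_1^*,\quad x_2^*x_2=x_2x_2^*+(1-q^2)x_1x_1^*,\quad x_2^*x_3=q^2x_3x_2^*,$$ $$x_2^*x_4=qx_4x_2^*+q^2(q-q^{-1})x_3x_1^*,\quad x_3^*x_3=x_3x_3^*+(1-q^4)x_2x_2^*+(1-q^2)x_1x_1^*,\quad x_3^*x_4=qx_4x_3^*-q^4(q-q^{-1})x_2x_1^*,$$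 $$x_1x_1^*+x_2x_2^*+x_3x_3^*+x_4x_4^*=1,\qquad q^8x_1^*x_1+q^6x_2^*x_2+q^2x_3^*x_3+x_4^*x_4=1,$$ together with their adjoints. Write $a_i^j$ for the entry of a matrix $a$ in row $i$ and column $j$, and $(a\,\dot\otimes\,b)_i^j=\sum_k a_i^k\otimes b_k^j$. Let $$u=(u^0,u^1)=\begin{pmatrix}qx_1&qx_2\\-q^2x_2^*&q^3x_1^*\\-x_3&x_4\\x_4^*&qx_3^*\end{pmatrix},$$ let $\delta_R:\mathcal{O}(S^7_q)\to\mathcal{O}(S^7_q)\otimes\mathcal{O}(SU_q(2))$ be the algebra homomorphism with $\delta_R(u)=u\,\dot\otimes\,T^{(1)}$ (applied entrywise), and let $\mathcal{O}(S^4_q)=\{b\in\mathcal{O}(S^7_q):\delta_R(b)=b\otimes1\}$. **Corepresentations.** Put $[n]=\frac{1-q^{2n}}{1-q^2}$ and, for $0\le k\le n$, ${n\brack k}=\prod_{i=k+1}^n(1-q^{2i})\big/\prod_{j=1}^{n-k}(1-q^{2j})$. Let $T^{(n)}\in M_{n+1}(\mathcal{O}(SU_q(2)))$ be the unitary matrix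 of the $(n+1)$-dimensional irreducible corepresentation, with rows and columns numbered from $0$ to $n$: $$(T^{(n)})_k^j={n\brack k}^{\frac12}{n\brack j}^{-\frac12}\sum_{\substack{0\le i\le k,\ 0\le l\le n-k\\ i+l=j}}{k\brack i}{n-k\brack l}\,q^{(k-i)l}(-q)^l\,(\alpha^*)^i\gamma^{k-i}(\gamma^*)^l\alpha^{n-k-l}.$$ Let $V_n=\mathbb{C}^{n+1}$ with the left coaction $\delta_L(e_i)=\sum_j(T^{(n)})_i^j\otimes e_j$, and let $$\mathscr{E}_n=\mathcal{O}(S^7_q)\,\Box^{\mathcal{O}(SU_q(2))}\,V_n=\{\xi\in\mathcal{O}(S^7_q)\otimes V_n:(\delta_R\otimes\mathrm{id})\xi=(\mathrm{id}\otimes\delta_L)\xi\},$$ a right $\mathcal{O}(S^4_q)$-module by right multiplication on the first factor. **The matrices.** For column vectors $v,w$ let $v\bullet w$ be the column vector with components $v_iw_j$, indexed by the pairs $(i,j)$. Let $U^{(1)}=u$ and, for $n\ge2$, let $U^{(n)}\in M_{4^n\times(n+1)}(\mathcal{O}(S^7_q))$ be the matrix with columns $$(U^{(n)})^k=[n]^{-\frac12}\Big(q^k[n-k]^{\frac12}\,u^0\bullet(U^{(n-1)})^k+[k]^{\frac12}\,u^1\bullet(U^{(n-1)})^{k-1}\Big),\qquad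 k=0,\dots,n,$$ where the columns $n$ and $-1$ of $U^{(n-1)}$ are read as $0$. **Statement.** For every $n\ge1$, $$(U^{(n)})^*U^{(n)}=1_{n+1},\qquad \delta_R(U^{(n)})=U^{(n)}\,\dot\otimes\,T^{(n)}.$$ Moreover all the entries of $P^{(n)}:=U^{(n)}(U^{(n)})^*$ lie in $\mathcal{O}(S^4_q)$, the matrix $P^{(n)}\in M_{4^n}(\mathcal{O}(S^4_q))$ is a projection, $(P^{(n)})^2=P^{(n)}=(P^{(n)})^*$, and $P^{(n)}\,\mathcal{O}(S^4_q)^{4^n}\cong\mathscr{E}_n$ as right $\mathcal{O}(S^4_q)$-modules. -/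

import Mathlib

open scoped TensorProduct Matrix

noncomputable section

namespace QuantumInstanton

/-! ### Presentations of unital *-algebras over the complex numbers -/

/-- The opposite ring of `C`, with scalars acting through complex conjugation. A conjugate-linear
anti-homomorphism into `C` is the same as a `ℂ`-algebra homomorphism into `ConjOp C`. -/
def ConjOp (C : Type) : Type := Cᵐᵒᵖ

instance (C : Type) [Ring C] : Ring (ConjOp C) := inferInstanceAs (Ring Cᵐᵒᵖ)

instance (C : Type) [Ring C] [Algebra ℂ C] : Algebra ℂ (ConjOp C) :=
  RingHom.toAlgebra' ((algebraMap ℂ Cᵐᵒᵖ).comp (starRingEnd ℂ))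
    (fun c x => Algebra.commutes (A := Cᵐᵒᵖ) (starRingEnd ℂ c) x)

/-- The underlying element of `C`. -/
def ConjOp.out {C : Type} (x : ConjOp C) : C := MulOpposite.unop x

/-- An element of `C`, seen in `ConjOp C`. -/
def ConjOp.into {C : Type} (x : C) : ConjOp C := MulOpposite.op x

@[simp] lemma ConjOp.out_into {C : Type} (x : C) : (ConjOp.into x).out = x := rfl

@[simp] lemma ConjOp.out_mul {C : Type} [Ring C] (x y : ConjOp C) : (x * y).out = y.out * x.out := rfl

@[simp] lemma ConjOp.out_add {C : Type} [Ring C] (x y : ConjOp C) : (x + y).out = x.out + y.out := rfl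

@[simp] lemma ConjOp.out_algebraMap {C : Type} [Ring C] [Algebra ℂ C] (z : ℂ) :
    (algebraMap ℂ (ConjOp C) z).out = algebraMap ℂ C (starRingEnd ℂ z) := rfl

lemma ConjOp.out_injective {C : Type} : Function.Injective (ConjOp.out (C := C)) :=
  MulOpposite.unop_injective

/-- The free unital complex *-algebra on `X`: noncommutative polynomials in letters `x` and `x^*`,
`x ∈ X`; the left summand holds the letters `x`, the right summand the letters `x^*`. -/
def FreeStarAlg (X : Type) : Type := FreeAlgebra ℂ (X ⊕ X)

namespace FreeStarAlg

variable {X : Type}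

instance : Ring (FreeStarAlg X) := inferInstanceAs (Ring (FreeAlgebra ℂ (X ⊕ X)))

instance : Algebra ℂ (FreeStarAlg X) := inferInstanceAs (Algebra ℂ (FreeAlgebra ℂ (X ⊕ X)))

/-- The letters. -/
def letter (y : X ⊕ X) : FreeStarAlg X := FreeAlgebra.ι ℂ y

/-- The generator `x`. -/
def gen (x : X) : FreeStarAlg X := letter (Sum.inl x)

/-- Algebra homomorphisms out of the free *-algebra are given by the images of the letters. -/
def liftAlg {C : Type} [Ring C] [Algebra ℂ C] (f : X ⊕ X → C) : FreeStarAlg X →ₐ[ℂ] C :=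
  FreeAlgebra.lift ℂ f

@[simp] lemma liftAlg_letter {C : Type} [Ring C] [Algebra ℂ C] (f : X ⊕ X → C) (y : X ⊕ X) :
    liftAlg f (letter y) = f y := FreeAlgebra.lift_ι_apply f y

lemma induction {p : FreeStarAlg X → Prop} (h1 : ∀ z : ℂ, p (algebraMap ℂ _ z))
    (h2 : ∀ y, p (letter y)) (h3 : ∀ a b, p a → p b → p (a * b))
    (h4 : ∀ a b, p a → p b → p (a + b)) (a : FreeStarAlg X) : p a :=
  FreeAlgebra.induction ℂ (X ⊕ X) (motive := p) h1 h2 h3 h4 a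

/-- The conjugate-linear anti-automorphism that exchanges `x` and `x^*`. -/
def starHom : FreeStarAlg X →ₐ[ℂ] ConjOp (FreeStarAlg X) :=
  liftAlg (fun y => ConjOp.into (letter y.swap))

lemma starHom_starHom (a : FreeStarAlg X) : (starHom (starHom a).out).out = a := by
  induction a using FreeStarAlg.induction with
  | h1 z => simp
  | h2 y => simp [starHom]
  | h3 a b ha hb => simp [ha, hb]
  | h4 a b ha hb => simp [ha, hb]

instance : StarRing (FreeStarAlg X) where
  star a := (starHom a).out
  star_involutive := starHom_starHom
  star_mul a b := by simp
  star_add a b := by simp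

lemma star_def (a : FreeStarAlg X) : star a = (starHom a).out := rfl

@[simp] lemma star_letter (y : X ⊕ X) : star (letter y) = letter y.swap := by
  simp [star_def, starHom]

@[simp] lemma star_algebraMap (z : ℂ) :
    star (algebraMap ℂ (FreeStarAlg X) z) = algebraMap ℂ _ (star z) := by
  simp [star_def]

instance : StarModule ℂ (FreeStarAlg X) where
  star_smul z a := by
    rw [Algebra.smul_def, Algebra.smul_def, star_mul, star_algebraMap, Algebra.commutes]

/-- The universal property of the free *-algebra. -/
def lift {C : Type} [Ring C] [Algebra ℂ C] [StarRing C] [StarModule ℂ C] (f : X → C) :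
    FreeStarAlg X →⋆ₐ[ℂ] C where
  __ := liftAlg (Sum.elim f (fun x => star (f x)))
  map_star' a := by
    change liftAlg _ (star a) = star (liftAlg _ a)
    induction a using FreeStarAlg.induction with
    | h1 z => simpa using algebraMap_star_comm (A := C) z
    | h2 y => rcases y with y | y <;> simp
    | h3 a b ha hb => simp [ha, hb]
    | h4 a b ha hb => simp [ha, hb]

@[simp] lemma lift_gen {C : Type} [Ring C] [Algebra ℂ C] [StarRing C] [StarModule ℂ C]
    (f : X → C) (x : X) : lift f (gen x) = f x :=
  liftAlg_letter _ (Sum.inl x)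

end FreeStarAlg

/-- The relations `r` together with their adjoints. -/
inductive StarClosure {F : Type} [Star F] (r : F → F → Prop) : F → F → Prop
  | of {a b : F} (h : r a b) : StarClosure r a b
  | adj {a b : F} (h : r a b) : StarClosure r (star a) (star b)

/-- The unital complex *-algebra with generators `X` and relations `a = b` for `r a b`. -/
def StarAlg {X : Type} (r : FreeStarAlg X → FreeStarAlg X → Prop) : Type :=
  RingQuot (StarClosure r)

namespace StarAlg

variable {X : Type} {r : FreeStarAlg X → FreeStarAlg X → Prop}

instance : Ring (StarAlg r) := inferInstanceAs (Ring (RingQuot (StarClosure r)))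

instance : Algebra ℂ (StarAlg r) := inferInstanceAs (Algebra ℂ (RingQuot (StarClosure r)))

variable (r) in
/-- The quotient map, as an algebra homomorphism. -/
def mkAlg : FreeStarAlg X →ₐ[ℂ] StarAlg r := RingQuot.mkAlgHom ℂ (StarClosure r)

lemma mkAlg_surjective : Function.Surjective (mkAlg r) :=
  RingQuot.mkAlgHom_surjective ℂ (StarClosure r)

lemma mkAlg_rel {a b : FreeStarAlg X} (h : StarClosure r a b) : mkAlg r a = mkAlg r b :=
  RingQuot.mkAlgHom_rel ℂ h

/-- Algebra homomorphisms out of the quotient. -/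
def liftAlg {C : Type} [Ring C] [Algebra ℂ C] (f : FreeStarAlg X →ₐ[ℂ] C)
    (hf : ∀ ⦃a b⦄, StarClosure r a b → f a = f b) : StarAlg r →ₐ[ℂ] C :=
  RingQuot.liftAlgHom ℂ ⟨f, hf⟩

@[simp] lemma liftAlg_mkAlg {C : Type} [Ring C] [Algebra ℂ C] (f : FreeStarAlg X →ₐ[ℂ] C)
    (hf : ∀ ⦃a b⦄, StarClosure r a b → f a = f b) (a : FreeStarAlg X) :
    liftAlg f hf (mkAlg r a) = f a :=
  RingQuot.liftAlgHom_mkAlgHom_apply ℂ f hf a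

/-- A homomorphism `A → C` seen as a homomorphism `ConjOp A → ConjOp C`. -/
def conjOpMap {A C : Type} [Ring A] [Ring C] [Algebra ℂ A] [Algebra ℂ C] (f : A →ₐ[ℂ] C) :
    ConjOp A →ₐ[ℂ] ConjOp C where
  toFun a := ConjOp.into (f a.out)
  map_one' := congrArg ConjOp.into (map_one f)
  map_mul' a b := ConjOp.out_injective (by simp)
  map_zero' := congrArg ConjOp.into (map_zero f)
  map_add' a b := ConjOp.out_injective (by simp)
  commutes' z := ConjOp.out_injective (by simp)

@[simp] lemma out_conjOpMap {A C : Type} [Ring A] [Ring C] [Algebra ℂ A] [Algebra ℂ C]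
    (f : A →ₐ[ℂ] C) (a : ConjOp A) : (conjOpMap f a).out = f a.out := rfl

/-- The involution of the quotient. -/
def starHom : StarAlg r →ₐ[ℂ] ConjOp (StarAlg r) :=
  liftAlg ((conjOpMap (mkAlg r)).comp FreeStarAlg.starHom) (by
    intro a b h
    apply ConjOp.out_injective
    change mkAlg r (star a) = mkAlg r (star b)
    cases h with
    | of h => exact mkAlg_rel (StarClosure.adj h)
    | adj h => rw [star_star, star_star]; exact mkAlg_rel (StarClosure.of h))

lemma out_starHom_mkAlg (a : FreeStarAlg X) :
    (starHom (mkAlg r a)).out = mkAlg r (star a) := by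
  simp [starHom, FreeStarAlg.star_def]

instance : StarRing (StarAlg r) where
  star a := (starHom a).out
  star_involutive a := by
    obtain ⟨a, rfl⟩ := mkAlg_surjective a
    simp only [out_starHom_mkAlg, star_star]
  star_mul a b := by simp
  star_add a b := by simp

lemma mkAlg_star (a : FreeStarAlg X) : mkAlg r (star a) = star (mkAlg r a) :=
  (out_starHom_mkAlg a).symm

instance : StarModule ℂ (StarAlg r) where
  star_smul z a := by
    obtain ⟨a, rfl⟩ := mkAlg_surjective a
    rw [← map_smul, ← mkAlg_star, ← mkAlg_star, ← map_smul, star_smul]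

variable (r) in
/-- The quotient map, as a *-homomorphism. -/
def mk : FreeStarAlg X →⋆ₐ[ℂ] StarAlg r where
  __ := mkAlg r
  map_star' := mkAlg_star

lemma mk_rel {a b : FreeStarAlg X} (h : r a b) : mk r a = mk r b := mkAlg_rel (.of h)

variable (r) in
/-- The generators of the quotient. -/
def gen (x : X) : StarAlg r := mk r (FreeStarAlg.gen x)

/-- The universal property: a *-homomorphism is given by images of the generators that satisfy
the relations. -/
def lift {C : Type} [Ring C] [Algebra ℂ C] [StarRing C] [StarModule ℂ C] (f : X → C)
    (hf : ∀ a b, r a b → FreeStarAlg.lift f a = FreeStarAlg.lift f b) : StarAlg r →⋆ₐ[ℂ] C where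
  __ := liftAlg (FreeStarAlg.lift f).toAlgHom (by
    intro a b h
    change FreeStarAlg.lift f a = FreeStarAlg.lift f b
    cases h with
    | of h => exact hf _ _ h
    | adj h => rw [map_star, map_star, hf _ _ h])
  map_star' a := by
    obtain ⟨a, rfl⟩ := mkAlg_surjective a
    change liftAlg _ _ (star (mkAlg r a)) = star (liftAlg _ _ (mkAlg r a))
    rw [← mkAlg_star, liftAlg_mkAlg, liftAlg_mkAlg]
    exact map_star (FreeStarAlg.lift f) a

@[simp] lemma lift_gen {C : Type} [Ring C] [Algebra ℂ C] [StarRing C] [StarModule ℂ C] (f : X → C)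
    (hf : ∀ a b, r a b → FreeStarAlg.lift f a = FreeStarAlg.lift f b) (x : X) :
    lift f hf (gen r x) = f x :=
  (liftAlg_mkAlg (r := r) (FreeStarAlg.lift f).toAlgHom _ _).trans (FreeStarAlg.lift_gen f x)

end StarAlg

/-! ### The quantum group and the quantum spheres -/

/-- The deformation parameter, a real number with `0 < q < 1`. -/
abbrev Par : Type := Set.Ioo (0 : ℝ) 1

/-- The deformation parameter as a complex number. -/
def Par.c (q : Par) : ℂ := ((q : ℝ) : ℂ)

lemma Par.c_ne_zero (q : Par) : q.c ≠ 0 := by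
  simpa [Par.c] using q.2.1.ne'

@[simp] lemma Par.star_c (q : Par) : star q.c = q.c := Complex.conj_ofReal _

/-- The matrix with rows `(a, -q c^*)` and `(c, a^*)`. -/
def fundMatrix (q : Par) {C : Type} [Ring C] [Algebra ℂ C] [Star C] (a c : C) :
    Matrix (Fin 2) (Fin 2) C :=
  !![a, -(q.c • star c); c, star a]

/-- The relations of `O(SU_q(2))`: the matrix with rows `(α, -q γ^*)` and `(γ, α^*)` is unitary.
The generators are `α = gen 0` and `γ = gen 1`. -/
inductive SUq2Rel (q : Par) : FreeStarAlg (Fin 2) → FreeStarAlg (Fin 2) → Prop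
  | left (i j : Fin 2) : SUq2Rel q
      (((fundMatrix q (.gen 0) (.gen 1))ᴴ * fundMatrix q (.gen 0) (.gen 1) :
        Matrix (Fin 2) (Fin 2) (FreeStarAlg (Fin 2))) i j)
      ((1 : Matrix (Fin 2) (Fin 2) (FreeStarAlg (Fin 2))) i j)
  | right (i j : Fin 2) : SUq2Rel q
      ((fundMatrix q (.gen 0) (.gen 1) * (fundMatrix q (.gen 0) (.gen 1))ᴴ :
        Matrix (Fin 2) (Fin 2) (FreeStarAlg (Fin 2))) i j)
      ((1 : Matrix (Fin 2) (Fin 2) (FreeStarAlg (Fin 2))) i j)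

/-- The *-algebra `O(SU_q(2))`. -/
abbrev SUq2 (q : Par) : Type := StarAlg (SUq2Rel q)

/-- The generator `α` of `O(SU_q(2))`. -/
def α (q : Par) : SUq2 q := StarAlg.gen _ 0

/-- The generator `γ` of `O(SU_q(2))`. -/
def γ (q : Par) : SUq2 q := StarAlg.gen _ 1

/-- The relations of the quantum symplectic 7-sphere. The generators `x_1, x_2, x_3, x_4` are
`gen 0, gen 1, gen 2, gen 3`. -/
inductive S7Rel (q : Par) : FreeStarAlg (Fin 4) → FreeStarAlg (Fin 4) → Prop
  | x12 : S7Rel q (.gen 0 * .gen 1) (q.c • (.gen 1 * .gen 0))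
  | x13 : S7Rel q (.gen 0 * .gen 2) (q.c • (.gen 2 * .gen 0))
  | x14 : S7Rel q (.gen 0 * .gen 3) (q.c ^ 2 • (.gen 3 * .gen 0))
  | x23 : S7Rel q (.gen 1 * .gen 2)
      (q.c ^ 2 • (.gen 2 * .gen 1) + (q.c ^ 2 * (q.c - q.c⁻¹)) • (.gen 3 * .gen 0))
  | x24 : S7Rel q (.gen 1 * .gen 3) (q.c • (.gen 3 * .gen 1))
  | x34 : S7Rel q (.gen 2 * .gen 3) (q.c • (.gen 3 * .gen 2))
  | s11 : S7Rel q (star (.gen 0) * .gen 0) (.gen 0 * star (.gen 0))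
  | s12 : S7Rel q (star (.gen 0) * .gen 1) (q.c • (.gen 1 * star (.gen 0)))
  | s13 : S7Rel q (star (.gen 0) * .gen 2) (q.c • (.gen 2 * star (.gen 0)))
  | s14 : S7Rel q (star (.gen 0) * .gen 3) (q.c ^ 2 • (.gen 3 * star (.gen 0)))
  | s22 : S7Rel q (star (.gen 1) * .gen 1)
      (.gen 1 * star (.gen 1) + (1 - q.c ^ 2) • (.gen 0 * star (.gen 0)))
  | s23 : S7Rel q (star (.gen 1) * .gen 2) (q.c ^ 2 • (.gen 2 * star (.gen 1)))
  | s24 : S7Rel q (star (.gen 1) * .gen 3)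
      (q.c • (.gen 3 * star (.gen 1)) + (q.c ^ 2 * (q.c - q.c⁻¹)) • (.gen 2 * star (.gen 0)))
  | s33 : S7Rel q (star (.gen 2) * .gen 2)
      (.gen 2 * star (.gen 2) + (1 - q.c ^ 4) • (.gen 1 * star (.gen 1))
        + (1 - q.c ^ 2) • (.gen 0 * star (.gen 0)))
  | s34 : S7Rel q (star (.gen 2) * .gen 3)
      (q.c • (.gen 3 * star (.gen 2)) - (q.c ^ 4 * (q.c - q.c⁻¹)) • (.gen 1 * star (.gen 0)))
  | sphere : S7Rel q
      (.gen 0 * star (.gen 0) + .gen 1 * star (.gen 1) + .gen 2 * star (.gen 2)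
        + .gen 3 * star (.gen 3)) 1
  | sphere' : S7Rel q
      (q.c ^ 8 • (star (.gen 0) * .gen 0) + q.c ^ 6 • (star (.gen 1) * .gen 1)
        + q.c ^ 2 • (star (.gen 2) * .gen 2) + star (.gen 3) * .gen 3) 1

/-- The *-algebra `O(S^7_q)`. -/
abbrev S7 (q : Par) : Type := StarAlg (S7Rel q)

/-- The generators of `O(S^7_q)`; `x q 0, x q 1, x q 2, x q 3` are `x_1, x_2, x_3, x_4`. -/
def x (q : Par) (i : Fin 4) : S7 q := StarAlg.gen _ i

/-! ### The coaction -/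

section Relations

variable (q : Par)

lemma su_left (i j : Fin 2) : ((fundMatrix q (α q) (γ q))ᴴ * fundMatrix q (α q) (γ q)) i j
    = (1 : Matrix (Fin 2) (Fin 2) (SUq2 q)) i j := by
  have h := StarAlg.mk_rel (SUq2Rel.left (q := q) i j)
  fin_cases i <;> fin_cases j <;>
    simpa [fundMatrix, Matrix.mul_apply, Fin.sum_univ_two, α, γ, StarAlg.gen, map_star] using h

lemma su_right (i j : Fin 2) : (fundMatrix q (α q) (γ q) * (fundMatrix q (α q) (γ q))ᴴ) i j
    = (1 : Matrix (Fin 2) (Fin 2) (SUq2 q)) i j := by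
  have h := StarAlg.mk_rel (SUq2Rel.right (q := q) i j)
  fin_cases i <;> fin_cases j <;>
    simpa [fundMatrix, Matrix.mul_apply, Fin.sum_univ_two, α, γ, StarAlg.gen, map_star] using h

lemma su_ag : α q * γ q = q.c • (γ q * α q) := by
  have h := su_left q 1 0
  simp [fundMatrix, Matrix.mul_apply, Fin.sum_univ_two] at h
  rw [neg_add_eq_zero] at h
  exact h.symm

lemma su_ags : α q * star (γ q) = q.c • (star (γ q) * α q) := by
  have h := su_right q 0 1
  simp [fundMatrix, Matrix.mul_apply, Fin.sum_univ_two] at h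
  rwa [add_neg_eq_zero] at h

lemma su_asg : star (α q) * γ q = q.c⁻¹ • (γ q * star (α q)) := by
  have h := congrArg star (su_ags q)
  simp at h
  rw [h, smul_smul, inv_mul_cancel₀ q.c_ne_zero, one_smul]

lemma su_asgs : star (α q) * star (γ q) = q.c⁻¹ • (star (γ q) * star (α q)) := by
  have h := congrArg star (su_ag q)
  simp at h
  rw [h, smul_smul, inv_mul_cancel₀ q.c_ne_zero, one_smul]

lemma su_gsg : star (γ q) * γ q = γ q * star (γ q) := by
  have h := su_left q 0 0
  have h' := su_right q 1 1
  simp [fundMatrix, Matrix.mul_apply, Fin.sum_univ_two] at h h'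
  rw [add_comm] at h
  exact add_right_cancel (h.trans h'.symm)

lemma su_asa : star (α q) * α q = 1 - γ q * star (γ q) := by
  have h := su_left q 0 0
  simp [fundMatrix, Matrix.mul_apply, Fin.sum_univ_two] at h
  rw [← h, su_gsg]; abel

lemma su_aas : α q * star (α q) = 1 - q.c ^ 2 • (γ q * star (γ q)) := by
  have h := su_right q 0 0
  simp [fundMatrix, Matrix.mul_apply, Fin.sum_univ_two] at h
  rw [← h, su_gsg, smul_smul, pow_two]; abel

lemma S7Rel.eq {q : Par} {a b : FreeStarAlg (Fin 4)} (h : S7Rel q a b) :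
    StarAlg.mk (S7Rel q) a = StarAlg.mk (S7Rel q) b := StarAlg.mk_rel h

lemma x12 : x q 0 * x q 1 = q.c • (x q 1 * x q 0) := by
  simpa [x, StarAlg.gen, map_star] using (S7Rel.x12 (q := q)).eq
lemma x13 : x q 0 * x q 2 = q.c • (x q 2 * x q 0) := by
  simpa [x, StarAlg.gen, map_star] using (S7Rel.x13 (q := q)).eq
lemma x14 : x q 0 * x q 3 = q.c ^ 2 • (x q 3 * x q 0) := by
  simpa [x, StarAlg.gen, map_star] using (S7Rel.x14 (q := q)).eq
lemma x23 : x q 1 * x q 2 =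
    q.c ^ 2 • (x q 2 * x q 1) + (q.c ^ 2 * (q.c - q.c⁻¹)) • (x q 3 * x q 0) := by
  simpa only [x, StarAlg.gen, map_star, map_mul, map_add, map_smul] using (S7Rel.x23 (q := q)).eq
lemma x24 : x q 1 * x q 3 = q.c • (x q 3 * x q 1) := by
  simpa [x, StarAlg.gen, map_star] using (S7Rel.x24 (q := q)).eq
lemma x34 : x q 2 * x q 3 = q.c • (x q 3 * x q 2) := by
  simpa [x, StarAlg.gen, map_star] using (S7Rel.x34 (q := q)).eq
lemma s11 : star (x q 0) * x q 0 = x q 0 * star (x q 0) := by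
  simpa [x, StarAlg.gen, map_star] using (S7Rel.s11 (q := q)).eq
lemma s12 : star (x q 0) * x q 1 = q.c • (x q 1 * star (x q 0)) := by
  simpa [x, StarAlg.gen, map_star] using (S7Rel.s12 (q := q)).eq
lemma s13 : star (x q 0) * x q 2 = q.c • (x q 2 * star (x q 0)) := by
  simpa [x, StarAlg.gen, map_star] using (S7Rel.s13 (q := q)).eq
lemma s14 : star (x q 0) * x q 3 = q.c ^ 2 • (x q 3 * star (x q 0)) := by
  simpa [x, StarAlg.gen, map_star] using (S7Rel.s14 (q := q)).eq
lemma s22 : star (x q 1) * x q 1 =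
    x q 1 * star (x q 1) + (1 - q.c ^ 2) • (x q 0 * star (x q 0)) := by
  simpa only [x, StarAlg.gen, map_star, map_mul, map_add, map_smul] using (S7Rel.s22 (q := q)).eq
lemma s23 : star (x q 1) * x q 2 = q.c ^ 2 • (x q 2 * star (x q 1)) := by
  simpa [x, StarAlg.gen, map_star] using (S7Rel.s23 (q := q)).eq
lemma s24 : star (x q 1) * x q 3 =
    q.c • (x q 3 * star (x q 1)) + (q.c ^ 2 * (q.c - q.c⁻¹)) • (x q 2 * star (x q 0)) := by
  simpa only [x, StarAlg.gen, map_star, map_mul, map_add, map_smul] using (S7Rel.s24 (q := q)).eq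
lemma s33 : star (x q 2) * x q 2 = x q 2 * star (x q 2)
    + (1 - q.c ^ 4) • (x q 1 * star (x q 1)) + (1 - q.c ^ 2) • (x q 0 * star (x q 0)) := by
  simpa only [x, StarAlg.gen, map_star, map_mul, map_add, map_smul] using (S7Rel.s33 (q := q)).eq
lemma s34 : star (x q 2) * x q 3 =
    q.c • (x q 3 * star (x q 2)) - (q.c ^ 4 * (q.c - q.c⁻¹)) • (x q 1 * star (x q 0)) := by
  simpa only [x, StarAlg.gen, map_star, map_mul, map_sub, map_smul] using (S7Rel.s34 (q := q)).eq
lemma x44 : x q 3 * star (x q 3) = 1 - x q 0 * star (x q 0) - x q 1 * star (x q 1)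
    - x q 2 * star (x q 2) := by
  have h := (S7Rel.sphere (q := q)).eq
  simp only [map_star, map_mul, map_add, map_one] at h
  change x q 0 * star (x q 0) + x q 1 * star (x q 1) + x q 2 * star (x q 2)
    + x q 3 * star (x q 3) = 1 at h
  rw [← h]; abel
lemma s44 : star (x q 3) * x q 3 = 1 - q.c ^ 8 • (star (x q 0) * x q 0)
    - q.c ^ 6 • (star (x q 1) * x q 1) - q.c ^ 2 • (star (x q 2) * x q 2) := by
  have h := (S7Rel.sphere' (q := q)).eq
  simp only [map_star, map_mul, map_add, map_one, map_smul] at h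
  change q.c ^ 8 • (star (x q 0) * x q 0) + q.c ^ 6 • (star (x q 1) * x q 1)
    + q.c ^ 2 • (star (x q 2) * x q 2) + star (x q 3) * x q 3 = 1 at h
  rw [← h]; abel

lemma s21 : star (x q 1) * x q 0 = q.c • (x q 0 * star (x q 1)) := by
  simpa using congrArg star (s12 q)
lemma s43 : star (x q 3) * x q 2 =
    q.c • (x q 2 * star (x q 3)) - (q.c ^ 4 * (q.c - q.c⁻¹)) • (x q 0 * star (x q 1)) := by
  simpa [star_inv₀] using congrArg star (s34 q)

end Relations

/-- The images `x_1 ⊗ α + x_2 ⊗ γ`, `-q x_1 ⊗ γ^* + x_2 ⊗ α^*`, `x_3 ⊗ α - x_4 ⊗ γ`,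
`q x_3 ⊗ γ^* + x_4 ⊗ α^*` of the generators under the coaction. -/
def coactionGen (q : Par) : Fin 4 → S7 q ⊗[ℂ] SUq2 q :=
  ![x q 0 ⊗ₜ α q + x q 1 ⊗ₜ γ q,
    -(q.c • (x q 0 ⊗ₜ star (γ q))) + x q 1 ⊗ₜ star (α q),
    x q 2 ⊗ₜ α q - x q 3 ⊗ₜ γ q,
    q.c • (x q 2 ⊗ₜ star (γ q)) + x q 3 ⊗ₜ star (α q)]

lemma coactionGen_rel (q : Par) (a b : FreeStarAlg (Fin 4)) (h : S7Rel q a b) :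
    FreeStarAlg.lift (coactionGen q) a = FreeStarAlg.lift (coactionGen q) b := by
  have hq := q.c_ne_zero
  cases h <;>
  simp only [map_add, map_sub, map_mul, map_smul, map_star, map_one, FreeStarAlg.lift_gen,
    coactionGen, Matrix.cons_val, star_add, star_sub, star_neg, star_smul, star_star,
    TensorProduct.star_tmul, Par.star_c, mul_add, add_mul, mul_sub, sub_mul, neg_mul, mul_neg,
    smul_mul_assoc, mul_smul_comm, Algebra.TensorProduct.tmul_mul_tmul,
    su_ag, su_ags, su_asg, su_asgs, su_gsg, su_asa, su_aas,
    x12, x13, x14, x23, x24, x34, s11, s12, s13, s14, s22, s23, s24, s33, s34, x44, s44,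
    s21, s43, Algebra.TensorProduct.one_def,
    TensorProduct.add_tmul, TensorProduct.tmul_sub,
    TensorProduct.sub_tmul, TensorProduct.tmul_smul, ← TensorProduct.smul_tmul'] <;>
  match_scalars <;> field_simp <;> ring

/-- The coaction `δ_R : O(S^7_q) → O(S^7_q) ⊗ O(SU_q(2))`, a homomorphism of *-algebras. -/
def coaction (q : Par) : S7 q →⋆ₐ[ℂ] S7 q ⊗[ℂ] SUq2 q :=
  StarAlg.lift (coactionGen q) (coactionGen_rel q)

/-- The dotted tensor product `(a ⊗̇ b)_i^j = ∑_k a_i^k ⊗ b_k^j` of matrices. -/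
def dotTensor {A H l m p : Type} [Ring A] [Algebra ℂ A] [Ring H] [Algebra ℂ H] [Fintype m]
    (a : Matrix l m A) (b : Matrix m p H) : Matrix l p (A ⊗[ℂ] H) :=
  Matrix.of fun i j => ∑ k, a i k ⊗ₜ[ℂ] b k j

/-- The `4 × 2` matrix `u`. -/
def u (q : Par) : Matrix (Fin 4) (Fin 2) (S7 q) :=
  !![q.c • x q 0, q.c • x q 1;
     -(q.c ^ 2 • star (x q 1)), q.c ^ 3 • star (x q 0);
     -(x q 2), x q 3;
     star (x q 3), q.c • star (x q 2)]

/-- The defining formula of the coaction: `δ_R(u) = u ⊗̇ T^(1)`. Since the entries of `u` generate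
the algebra `O(S^7_q)`, this determines `δ_R` as an algebra homomorphism. -/
lemma coaction_u (q : Par) :
    (u q).map (coaction q) = dotTensor (u q) (fundMatrix q (α q) (γ q)) := by
  have hx : ∀ i, coaction q (x q i) = coactionGen q i := fun i => StarAlg.lift_gen _ _ i
  ext i j
  fin_cases i <;> fin_cases j <;>
    simp [u, dotTensor, fundMatrix, Fin.sum_univ_two, hx, coactionGen, map_star,
      TensorProduct.tmul_neg, TensorProduct.neg_tmul, TensorProduct.tmul_smul,
      ← TensorProduct.smul_tmul'] <;>
    module

/-- The *-algebra `O(S^4_q)` of elements `b` of `O(S^7_q)` with `δ_R(b) = b ⊗ 1`. -/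
def S4 (q : Par) : StarSubalgebra ℂ (S7 q) where
  carrier := {b | coaction q b = b ⊗ₜ 1}
  mul_mem' {a b} ha hb := by
    simp only [Set.mem_ofPred_eq] at ha hb ⊢
    rw [map_mul, ha, hb, Algebra.TensorProduct.tmul_mul_tmul, mul_one]
  add_mem' {a b} ha hb := by
    simp only [Set.mem_ofPred_eq] at ha hb ⊢
    rw [map_add, ha, hb, TensorProduct.add_tmul]
  algebraMap_mem' z := by
    simp only [Set.mem_ofPred_eq]
    rw [AlgHomClass.commutes, Algebra.TensorProduct.algebraMap_apply]
  star_mem' {a} ha := by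
    simp only [Set.mem_ofPred_eq] at ha ⊢
    rw [map_star, ha, TensorProduct.star_tmul, star_one]

lemma mem_S4 {q : Par} {b : S7 q} : b ∈ S4 q ↔ coaction q b = b ⊗ₜ 1 := Iff.rfl

/-! ### Corepresentations and associated modules -/

/-- The `q`-number `[n] = (1 - q^(2n)) / (1 - q^2)`. -/
def qnum (q : Par) (n : ℕ) : ℝ := (1 - (q : ℝ) ^ (2 * n)) / (1 - (q : ℝ) ^ 2)

/-- The `q`-binomial coefficient, for `k ≤ n`. -/
def qbin (q : Par) (n k : ℕ) : ℝ :=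
  (∏ i ∈ Finset.Icc (k + 1) n, (1 - (q : ℝ) ^ (2 * i))) /
    ∏ j ∈ Finset.Icc 1 (n - k), (1 - (q : ℝ) ^ (2 * j))

/-- The unitary matrix `T^(n)` of the irreducible corepresentation of `O(SU_q(2))` of dimension
`n + 1`: the entry in row `k` and column `j` is
`([n,k] / [n,j])^(1/2) ∑_{i + l = j} [k,i] [n-k,l] q^((k-i) l) (-q)^l α^*^i γ^(k-i) γ^*^l α^(n-k-l)`,
where `[m,i]` is the `q`-binomial coefficient and `0 ≤ i ≤ k`, `0 ≤ l ≤ n - k`.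
These are the elements determined by `Δ(e_k) = ∑_j T^(n)_k^j ⊗ e_j` for the comultiplication `Δ`
and `e_k = [n,k]^(1/2) γ^k α^(n-k)`, which form column `0` of the matrix. -/
def T (q : Par) (n : ℕ) : Matrix (Fin (n + 1)) (Fin (n + 1)) (SUq2 q) :=
  Matrix.of fun k j =>
    ((Real.sqrt (qbin q n k / qbin q n j) : ℝ) : ℂ) •
      ∑ i ∈ Finset.range ((k : ℕ) + 1), ∑ l ∈ Finset.range (n - k + 1),
        if i + l = (j : ℕ) then
          (((qbin q k i * qbin q (n - k) l : ℝ) : ℂ) * q.c ^ ((k - i) * l) * (-q.c) ^ l) •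
            (star (α q) ^ i * γ q ^ (k - i) * star (γ q) ^ l * α q ^ (n - k - l))
        else 0

/-- `T^(1)` is the matrix with rows `(α, -q γ^*)` and `(γ, α^*)`. -/
lemma T_one (q : Par) : T q 1 = fundMatrix q (α q) (γ q) := by
  have h : (1 - (q : ℝ) ^ 2) ≠ 0 := by
    have h0 := q.2.1
    have h1 := q.2.2
    nlinarith
  have hc : (1 - ((q : ℝ) : ℂ) ^ 2) ≠ 0 := by exact_mod_cast h
  ext k j
  fin_cases k <;> fin_cases j <;>
    simp [T, fundMatrix, qbin, Finset.sum_range_succ, div_self h, div_self hc]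

/-- The left coaction `δ_L(e_i) = ∑_j T^(n)_i^j ⊗ e_j` on `V_n = ℂ^(n+1)`. -/
def coactionV (q : Par) (n : ℕ) : (Fin (n + 1) → ℂ) →ₗ[ℂ] SUq2 q ⊗[ℂ] (Fin (n + 1) → ℂ) :=
  (Pi.basisFun ℂ (Fin (n + 1))).constr ℂ fun i => ∑ j, T q n i j ⊗ₜ[ℂ] Pi.single j (1 : ℂ)

/-- The cotensor product `A □^H V` of a right coaction `A → A ⊗ H` and a left coaction
`V → H ⊗ V`. -/
def cotensor {A H V : Type} [AddCommGroup A] [Module ℂ A] [AddCommGroup H] [Module ℂ H]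
    [AddCommGroup V] [Module ℂ V] (δR : A →ₗ[ℂ] A ⊗[ℂ] H) (δL : V →ₗ[ℂ] H ⊗[ℂ] V) :
    Submodule ℂ (A ⊗[ℂ] V) :=
  LinearMap.eqLocus ((TensorProduct.assoc ℂ A H V).toLinearMap ∘ₗ δR.rTensor V) (δL.lTensor A)

/-- `O(S^7_q)` is a right `O(S^4_q)`-module by right multiplication. -/
instance (q : Par) : Module (S4 q)ᵐᵒᵖ (S7 q) :=
  Module.compHom (S7 q) (RingHom.op (S4 q).subtype.toAlgHom.toRingHom)

lemma op_smul_def {q : Par} (b : (S4 q)ᵐᵒᵖ) (a : S7 q) : b • a = a * (b.unop : S7 q) := rfl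

instance (q : Par) : SMulCommClass ℂ (S4 q)ᵐᵒᵖ (S7 q) where
  smul_comm z b a := by simp [op_smul_def]

/-- Right multiplication by `b ∈ O(S^4_q)` on the first leg of `O(S^7_q) ⊗ V`. -/
lemma op_smul_tmul {q : Par} {V : Type} [AddCommGroup V] [Module ℂ V] (b : (S4 q)ᵐᵒᵖ) (a : S7 q)
    (v : V) : b • (a ⊗ₜ[ℂ] v) = (a * (b.unop : S7 q)) ⊗ₜ[ℂ] v := rfl

/-- The right `O(S^4_q)`-module `ℰ_n = O(S^7_q) □^H V_n`, `H = O(SU_q(2))`. -/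
def E (q : Par) (n : ℕ) : Submodule (S4 q)ᵐᵒᵖ (S7 q ⊗[ℂ] (Fin (n + 1) → ℂ)) where
  carrier := cotensor (coaction q).toAlgHom.toLinearMap (coactionV q n)
  add_mem' := (cotensor (coaction q).toAlgHom.toLinearMap (coactionV q n)).add_mem
  zero_mem' := (cotensor (coaction q).toAlgHom.toLinearMap (coactionV q n)).zero_mem
  smul_mem' b ξ hξ := by
    let R : S7 q ⊗[ℂ] (SUq2 q ⊗[ℂ] (Fin (n + 1) → ℂ)) →ₗ[ℂ]
        S7 q ⊗[ℂ] (SUq2 q ⊗[ℂ] (Fin (n + 1) → ℂ)) :=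
      LinearMap.rTensor _ (LinearMap.mulRight ℂ (b.unop : S7 q))
    have hb : coaction q (b.unop : S7 q) = (b.unop : S7 q) ⊗ₜ 1 := b.unop.2
    have h1 : ∀ ξ : S7 q ⊗[ℂ] (Fin (n + 1) → ℂ),
        (coactionV q n).lTensor (S7 q) (b • ξ) = R ((coactionV q n).lTensor (S7 q) ξ) := by
      intro ξ
      induction ξ using TensorProduct.induction_on with
      | zero => simp
      | add y z hy hz => simp only [smul_add, map_add, hy, hz]
      | tmul a v =>
        rw [op_smul_tmul, LinearMap.lTensor_tmul, LinearMap.lTensor_tmul, LinearMap.rTensor_tmul,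
          LinearMap.mulRight_apply]
    have h3 : ∀ (c : S7 q ⊗[ℂ] SUq2 q) (v : Fin (n + 1) → ℂ),
        TensorProduct.assoc ℂ _ _ _ ((c * ((b.unop : S7 q) ⊗ₜ 1)) ⊗ₜ[ℂ] v)
          = R (TensorProduct.assoc ℂ _ _ _ (c ⊗ₜ[ℂ] v)) := by
      intro c v
      induction c using TensorProduct.induction_on with
      | zero => simp
      | add y z hy hz => simp only [add_mul, TensorProduct.add_tmul, map_add, hy, hz]
      | tmul a h => simp [R]
    have h2 : ∀ ξ : S7 q ⊗[ℂ] (Fin (n + 1) → ℂ),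
        TensorProduct.assoc ℂ _ _ _
            ((coaction q).toAlgHom.toLinearMap.rTensor (Fin (n + 1) → ℂ) (b • ξ))
          = R (TensorProduct.assoc ℂ _ _ _
            ((coaction q).toAlgHom.toLinearMap.rTensor (Fin (n + 1) → ℂ) ξ)) := by
      intro ξ
      induction ξ using TensorProduct.induction_on with
      | zero => simp
      | add y z hy hz => simp only [smul_add, map_add, hy, hz]
      | tmul a v =>
        rw [op_smul_tmul, LinearMap.rTensor_tmul, LinearMap.rTensor_tmul]
        change TensorProduct.assoc ℂ _ _ _ (coaction q (a * (b.unop : S7 q)) ⊗ₜ[ℂ] v) = _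
        rw [map_mul, hb, h3]
        rfl
    change TensorProduct.assoc ℂ _ _ _
      ((coaction q).toAlgHom.toLinearMap.rTensor (Fin (n + 1) → ℂ) (b • ξ))
        = (coactionV q n).lTensor (S7 q) (b • ξ)
    have hξ' : TensorProduct.assoc ℂ _ _ _
      ((coaction q).toAlgHom.toLinearMap.rTensor (Fin (n + 1) → ℂ) ξ)
        = (coactionV q n).lTensor (S7 q) ξ := hξ
    rw [h1, h2, hξ']

/-! ### The matrices `U^(n)` -/

/-- The matrix `U^(n)`, with `4^n` rows labelled by multi-indices `I = (i_1, …, i_n)` and columns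
`0, …, n`. One has `U^(1) = u`, and column `k` of `U^(n)`, `n ≥ 2`, is
`[n]^(-1/2) (q^k [n-k]^(1/2) u^0 • U^(n-1)^k + [k]^(1/2) u^1 • U^(n-1)^(k-1))`,
where `(v • w)_(i, J) = v_i w_J`, and where the columns `n` and `-1` of `U^(n-1)`
are zero. The case `n = 0` is a convention. -/
def U (q : Par) : (n : ℕ) → Matrix (Fin n → Fin 4) (Fin (n + 1)) (S7 q)
  | 0 => Matrix.of fun _ _ => 1
  | 1 => Matrix.of fun I k => u q (I 0) k
  | n + 2 => Matrix.of fun I k =>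
      (((Real.sqrt (qnum q (n + 2)))⁻¹ : ℝ) : ℂ) •
        ((q.c ^ (k : ℕ) * ((Real.sqrt (qnum q (n + 2 - k)) : ℝ) : ℂ)) •
            (u q (I 0) 0 *
              if h : (k : ℕ) < n + 2 then U q (n + 1) (Fin.tail I) ⟨k, h⟩ else 0)
          + ((Real.sqrt (qnum q k) : ℝ) : ℂ) •
            (u q (I 0) 1 *
              if h : 0 < (k : ℕ) then U q (n + 1) (Fin.tail I) ⟨k - 1, by omega⟩ else 0))

/-- The right `B`-module `P B^N`, the image of a square matrix `P` over `B` acting on columns. -/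
def imageModule {B ι : Type} [Ring B] [Fintype ι] (P : Matrix ι ι B) : Submodule Bᵐᵒᵖ (ι → B) where
  carrier := Set.range fun v => P *ᵥ v
  add_mem' := by
    rintro _ _ ⟨v, rfl⟩ ⟨w, rfl⟩
    exact ⟨v + w, Matrix.mulVec_add P v w⟩
  zero_mem' := ⟨0, Matrix.mulVec_zero P⟩
  smul_mem' := by
    rintro b _ ⟨v, rfl⟩
    exact ⟨b • v, Matrix.mulVec_smul P b v⟩

end QuantumInstanton

end

open QuantumInstanton

/-! Everything follows from an isometric embedding of corepresentations `V_(n+1) → V_1 ⊗ V_n`. Its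
matrix `C` (`embMatrix`) has real scalar entries, and the recursion for `U` says exactly that
`U^(n+1) = (u ⊗ U^(n)) C`, up to relabelling rows (`U_succ`). The identity `q^(2k) [n+1-k] + [k] =
[n+1]` gives `C^* C = 1`. Since Kronecker products of isometries are isometries even over
noncommutative rings, induction gives `U^* U = 1`.

Covariance of `U` reduces to the intertwining relation `(T^(1) ⊗ T^(n)) C = C T^(n+1)`
(`kronecker_mul_embMatrix`). Up to normalization, row `k` of `T^(n)` lists the coefficients of `(γ s
+ α^* t)^k (α s - q γ^* t)^(n-k)` on the quantum plane `s t = q t s`. The rows of `T^(1)` act as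
left multiplication by the two linear forms. These forms `q`-commute, so multiplying by either one
yields a row of `T^(n+1)` up to a power of `q`.

An algebra automorphism of `O(SU_q(2))` transposes every `T^(n)`. Applied to the intertwining
relation, it yields `T^(n+1) C^* = C^* (T^(1) ⊗ T^(n))`, and hence `T T^* = 1` by induction. This
makes the entries of `P = U U^*` coinvariant, and `U^* U = 1` makes `P` a projection.

For the module, `(-q)^k (T_k^j)^* = (-q)^j T_(n-k)^(n-j)` identifies `V_n` with its conjugate.
Reversing and rescaling the coordinates of an element of `ℰ_n` gives a column transforming with the
adjoint of `T`. Multiplication by `U` sends such columns to coinvariant vectors in the image of `P`,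
with inverse `U^*`.

All inductions start at `n = 0`, where `U` and `T` are trivial. -/

namespace QuantumInstanton

open scoped Kronecker

/-! ### `q`-binomial coefficients -/

/-- The `q`-factorial, without its normalization. -/
noncomputable def qfac (q : Par) (n : ℕ) : ℝ := ∏ i ∈ Finset.Icc 1 n, (1 - (q : ℝ) ^ (2 * i))

lemma one_sub_pow_pos (q : Par) (n : ℕ) : 0 < 1 - (q : ℝ) ^ (2 * (n + 1)) :=
  sub_pos.2 (pow_lt_one₀ q.2.1.le q.2.2 (by omega))

lemma one_sub_sq_pos (q : Par) : 0 < 1 - (q : ℝ) ^ 2 := one_sub_pow_pos q 0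

lemma qfac_succ (q : Par) (n : ℕ) : qfac q (n + 1) = qfac q n * (1 - (q : ℝ) ^ (2 * (n + 1))) := by
  rw [qfac, Finset.prod_Icc_succ_top (by omega), qfac]

lemma qfac_zero (q : Par) : qfac q 0 = 1 := by simp [qfac]

lemma qfac_pos (q : Par) (n : ℕ) : 0 < qfac q n := by
  induction n with
  | zero => simp [qfac_zero]
  | succ n ih => rw [qfac_succ]; exact mul_pos ih (one_sub_pow_pos q n)

lemma qbin_add (q : Par) (k m : ℕ) : qbin q (k + m) k = qfac q (k + m) / (qfac q k * qfac q m) := by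
  have h : qfac q k * ∏ i ∈ Finset.Icc (k + 1) (k + m), (1 - (q : ℝ) ^ (2 * i))
      = qfac q (k + m) := by
    induction m with
    | zero => simp
    | succ m ih =>
      rw [← add_assoc, Finset.prod_Icc_succ_top (by omega), ← mul_assoc, ih, ← qfac_succ]
  rw [qbin, ← h, Nat.add_sub_cancel_left, mul_div_mul_left _ _ (qfac_pos q k).ne']
  rfl

lemma qbin_pos (q : Par) (k m : ℕ) : 0 < qbin q (k + m) k := by
  rw [qbin_add]
  exact div_pos (qfac_pos q _) (mul_pos (qfac_pos q _) (qfac_pos q _))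

lemma qbin_zero_right (q : Par) (n : ℕ) : qbin q n 0 = 1 := by
  have h := qbin_add q 0 n
  rw [zero_add, qfac_zero, one_mul, div_self (qfac_pos q n).ne'] at h
  exact h

lemma qbin_self (q : Par) (n : ℕ) : qbin q n n = 1 := by
  have h := qbin_add q n 0
  rw [add_zero, qfac_zero, mul_one, div_self (qfac_pos q n).ne'] at h
  exact h

lemma qbin_symm (q : Par) {n k : ℕ} (h : k ≤ n) : qbin q n (n - k) = qbin q n k := by
  obtain ⟨m, rfl⟩ := Nat.exists_eq_add_of_le h
  rw [Nat.add_sub_cancel_left, qbin_add, add_comm k m, qbin_add, mul_comm (qfac q m)]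

/-- The `q`-Pascal identity. -/
lemma qbin_succ_succ (q : Par) {n k : ℕ} (h : k < n) :
    qbin q (n + 1) (k + 1) = (q : ℝ) ^ (2 * (k + 1)) * qbin q n (k + 1) + qbin q n k := by
  obtain ⟨m, rfl⟩ := Nat.exists_eq_add_of_lt h
  have h1 : qbin q (k + m + 1 + 1) (k + 1) =
      qfac q (k + m + 1 + 1) / (qfac q (k + 1) * qfac q (m + 1)) := by
    rw [show k + m + 1 + 1 = k + 1 + (m + 1) by omega, qbin_add]
  have h2 : qbin q (k + m + 1) (k + 1) = qfac q (k + m + 1) / (qfac q (k + 1) * qfac q m) := by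
    rw [show k + m + 1 = k + 1 + m by omega, qbin_add]
  rw [h1, h2, show k + m + 1 = k + (m + 1) by omega, qbin_add, qfac_succ q (k + (m + 1)),
    qfac_succ q m, qfac_succ q k]
  have e1 := (qfac_pos q k).ne'
  have e2 := (qfac_pos q m).ne'
  have e3 := (one_sub_pow_pos q k).ne'
  have e4 := (one_sub_pow_pos q m).ne'
  field_simp
  ring

/-- The summed form of the `q`-Pascal identity: it passes from the expansion of an `n`-th power to
that of the next one, with `X` holding the monomials. -/
lemma sum_qbin_succ {M : Type*} [AddCommGroup M] [Module ℂ M] (q : Par) (n : ℕ) (X : ℕ → M) :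
    ∑ i ∈ Finset.range (n + 1 + 1), (qbin q (n + 1) i : ℂ) • X i =
      ∑ i ∈ Finset.range (n + 1), (qbin q n i : ℂ) • (q.c ^ (2 * i) • X i + X (i + 1)) := by
  simp only [smul_add, Finset.sum_add_distrib]
  rw [Finset.sum_range_succ', Finset.sum_range_succ, Finset.sum_range_succ' _ n,
    Finset.sum_range_succ _ n]
  have h : ∀ i ∈ Finset.range n, (qbin q (n + 1) (i + 1) : ℂ) • X (i + 1) =
      (qbin q n (i + 1) : ℂ) • q.c ^ (2 * (i + 1)) • X (i + 1) + (qbin q n i : ℂ) • X (i + 1) := by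
    intro i hi
    rw [qbin_succ_succ q (Finset.mem_range.1 hi), smul_smul, ← add_smul]
    congr 1
    push_cast [Par.c]
    ring
  rw [Finset.sum_congr rfl h, Finset.sum_add_distrib]
  simp only [qbin_self, qbin_zero_right, Complex.ofReal_one, one_smul, mul_zero, pow_zero]
  abel

lemma qnum_nonneg (q : Par) (n : ℕ) : 0 ≤ qnum q n :=
  div_nonneg (sub_nonneg.2 (pow_le_one₀ q.2.1.le q.2.2.le)) (one_sub_sq_pos q).le

lemma qnum_succ_pos (q : Par) (n : ℕ) : 0 < qnum q (n + 1) :=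
  div_pos (one_sub_pow_pos q n) (one_sub_sq_pos q)

lemma qnum_zero (q : Par) : qnum q 0 = 0 := by simp [qnum]

lemma qnum_one (q : Par) : qnum q 1 = 1 := div_self (one_sub_sq_pos q).ne'

lemma qnum_add (q : Par) (k m : ℕ) : (q : ℝ) ^ (2 * k) * qnum q m + qnum q k = qnum q (k + m) := by
  rw [qnum, qnum, qnum]
  have := (one_sub_sq_pos q).ne'
  field_simp
  ring

lemma qfac_succ_eq (q : Par) (n : ℕ) :
    qfac q (n + 1) = (1 - (q : ℝ) ^ 2) * qnum q (n + 1) * qfac q n := by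
  have := (one_sub_sq_pos q).ne'
  rw [qfac_succ, qnum]
  field_simp

/-- This identity and the next one change the normalization of `T^(n)` into that of `T^(n+1)` once
the coefficients of the embedding are absorbed. -/
lemma qnum_mul_qbin_left (q : Par) (k m : ℕ) :
    qnum q (k + m + 1) * qbin q (k + m) k = qnum q (m + 1) * qbin q (k + m + 1) k := by
  rw [add_assoc k m 1, qbin_add, qbin_add, ← add_assoc k m 1, qfac_succ_eq, qfac_succ_eq]
  have e1 := (qfac_pos q k).ne'
  have e2 := (qfac_pos q m).ne'
  have e3 := (qnum_succ_pos q m).ne'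
  have e4 := (one_sub_sq_pos q).ne'
  field_simp

lemma qnum_mul_qbin_right (q : Par) (k m : ℕ) :
    qnum q (k + m + 1) * qbin q (k + m) k = qnum q (k + 1) * qbin q (k + m + 1) (k + 1) := by
  rw [show k + m + 1 = k + 1 + m by omega, qbin_add, qbin_add, show k + 1 + m = k + m + 1 by omega,
    qfac_succ_eq, qfac_succ_eq]
  have e1 := (qfac_pos q k).ne'
  have e2 := (qfac_pos q m).ne'
  have e3 := (qnum_succ_pos q k).ne'
  have e4 := (one_sub_sq_pos q).ne'
  field_simp

/-! ### The coefficient sequences of the corepresentation matrices -/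

section Coefficients

variable {q : Par}

/-- The sequence `a_(j-1)`, with the term of index `0` equal to `0`. -/
def shift {M : Type*} [Zero M] (G : ℕ → M) : ℕ → M
  | 0 => 0
  | j + 1 => G j

/-- Left multiplication by `a s + b t` on polynomials `∑ G_j t^j s^(n-j)` in the coordinates of the
quantum plane `s t = q t s`. -/
def planeMul (a b : SUq2 q) : (ℕ → SUq2 q) →ₗ[ℂ] (ℕ → SUq2 q) where
  toFun G j := q.c ^ j • (a * G j) + b * shift G j
  map_add' G G' := by
    funext j
    rcases j with _ | j
    · simp [shift, mul_add]
    · simp only [shift, Pi.add_apply, mul_add, smul_add]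
      abel
  map_smul' z G := by
    funext j
    rcases j with _ | j <;> simp [shift, smul_comm z]

lemma planeMul_apply (a b : SUq2 q) (G : ℕ → SUq2 q) (j : ℕ) :
    planeMul a b G j = q.c ^ j • (a * G j) + b * shift G j := rfl

lemma planeMul_single (a b c : SUq2 q) (j : ℕ) :
    planeMul a b (Pi.single j c) = Pi.single j (q.c ^ j • (a * c)) + Pi.single (j + 1) (b * c) := by
  funext i
  rw [planeMul_apply, Pi.add_apply]
  congr 1
  · by_cases h : i = j
    · subst h; simp
    · simp [h]
  · rcases i with _ | i
    · simp [shift]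
    · by_cases h : i = j
      · subst h; simp [shift]
      · simp [shift, h]

/-- The linear forms `α s - q γ^* t` and `γ s + α^* t` `q`-commute. After both sides are brought to
a common order by the relations of `O(SU_q(2))`, the coefficients agree. -/
lemma planeMul_comm (G : ℕ → SUq2 q) :
    planeMul (α q) (-(q.c • star (γ q))) (planeMul (γ q) (star (α q)) G) =
      q.c • planeMul (γ q) (star (α q)) (planeMul (α q) (-(q.c • star (γ q))) G) := by
  have hq := q.c_ne_zero
  have e1 (z : SUq2 q) : α q * (γ q * z) = q.c • (γ q * (α q * z)) := by
    rw [← mul_assoc, su_ag, smul_mul_assoc, mul_assoc]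
  have e2 (z : SUq2 q) : star (α q) * (star (γ q) * z) = q.c⁻¹ • (star (γ q) * (star (α q) * z)) := by
    rw [← mul_assoc, su_asgs, smul_mul_assoc, mul_assoc]
  have e3 (z : SUq2 q) : star (α q) * (α q * z) = z - γ q * (star (γ q) * z) := by
    rw [← mul_assoc, su_asa, sub_mul, one_mul, mul_assoc]
  have e4 (z : SUq2 q) : α q * (star (α q) * z) = z - q.c ^ 2 • (γ q * (star (γ q) * z)) := by
    rw [← mul_assoc, su_aas, sub_mul, one_mul, smul_mul_assoc, mul_assoc]
  have e5 (z : SUq2 q) : star (γ q) * (γ q * z) = γ q * (star (γ q) * z) := by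
    rw [← mul_assoc, su_gsg, mul_assoc]
  funext j
  -- Two shifts occur, so the indices 0 and 1 have fewer terms than the generic one.
  rcases j with _ | _ | j <;>
  simp only [Pi.smul_apply, planeMul_apply, shift, mul_add, mul_zero, mul_smul_comm, smul_mul_assoc,
    neg_mul, mul_neg, e1, e2, e3, e4, e5] <;>
  match_scalars <;> field_simp <;> ring

/-- The coefficients of `(γ s + α^* t)^k (α s - q γ^* t)^m`, with `s t = q t s`. -/
noncomputable def coeffSeq (q : Par) (k m : ℕ) : ℕ → SUq2 q :=
  ∑ l ∈ Finset.range (m + 1), ∑ i ∈ Finset.range (k + 1), Pi.single (i + l)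
    (((qbin q k i * qbin q m l : ℝ) * q.c ^ ((k - i) * l) * (-q.c) ^ l) •
      (star (α q) ^ i * γ q ^ (k - i) * star (γ q) ^ l * α q ^ (m - l)))

lemma mul_pow_of_smul {R : Type*} [Ring R] [Algebra ℂ R] {a b : R} {z : ℂ}
    (h : a * b = z • (b * a)) (n : ℕ) : a * b ^ n = z ^ n • (b ^ n * a) := by
  induction n with
  | zero => simp
  | succ n ih =>
    rw [pow_succ, ← mul_assoc, ih, smul_mul_assoc, mul_assoc, h, mul_smul_comm, smul_smul,
      ← pow_succ, mul_assoc]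

lemma su_gas : γ q * star (α q) = q.c • (star (α q) * γ q) := by
  rw [su_asg, smul_smul, mul_inv_cancel₀ q.c_ne_zero, one_smul]

lemma planeMul_coeffSeq_left (k m : ℕ) :
    planeMul (γ q) (star (α q)) (coeffSeq q k m) = coeffSeq q (k + 1) m := by
  rw [coeffSeq, coeffSeq, map_sum]
  refine Finset.sum_congr rfl fun l _ => ?_
  have key := sum_qbin_succ q k fun i => (Pi.single (i + l)
    (((qbin q m l : ℝ) * q.c ^ ((k + 1 - i) * l) * (-q.c) ^ l) •
      (star (α q) ^ i * γ q ^ (k + 1 - i) * star (γ q) ^ l * α q ^ (m - l))) : ℕ → SUq2 q)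
  rw [map_sum]
  refine Eq.trans ?_ (key.symm.trans ?_)
  · refine Finset.sum_congr rfl fun i hi => ?_
    obtain ⟨p, rfl⟩ := Nat.exists_eq_add_of_le (Nat.lt_succ_iff.1 (Finset.mem_range.1 hi))
    have h1 : i + p - i = p := by omega
    have h2 : i + p + 1 - i = p + 1 := by omega
    have h3 : i + p + 1 - (i + 1) = p := by omega
    -- Moving `γ` past `α^*^i` costs `q^i`. With the `q^(i+l)` of `planeMul` this makes the Pascal
    -- weight `q^(2i)`, and the remaining `q^l` raises the exponent `(k-i) l` to `(k+1-i) l`.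
    have h4 : γ q * (star (α q) ^ i * γ q ^ p * star (γ q) ^ l * α q ^ (m - l)) =
        q.c ^ i • (star (α q) ^ i * γ q ^ (p + 1) * star (γ q) ^ l * α q ^ (m - l)) := by
      simp only [mul_assoc, pow_succ' (γ q)]
      rw [← mul_assoc (γ q), mul_pow_of_smul su_gas, smul_mul_assoc, mul_assoc]
    have h5 : star (α q) * (star (α q) ^ i * γ q ^ p * star (γ q) ^ l * α q ^ (m - l)) =
        star (α q) ^ (i + 1) * γ q ^ p * star (γ q) ^ l * α q ^ (m - l) := by
      simp only [mul_assoc, pow_succ']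
    rw [planeMul_single, h1, h2, h3, mul_smul_comm, mul_smul_comm, h4, h5, smul_add,
      ← Pi.single_smul, ← Pi.single_smul, ← Pi.single_smul]
    simp only [smul_smul]
    rw [add_right_comm i 1 l]
    push_cast
    congr 3 <;> ring
  · refine Finset.sum_congr rfl fun i _ => ?_
    rw [← Pi.single_smul, smul_smul]
    push_cast
    congr 2
    ring

/-- The Pascal weight `q^(2l)` arises from one `q^l` for `s` passing `t^l` and another for `α`
passing `γ^*^l`. -/
lemma planeMul_coeffSeq_zero (m : ℕ) :
    planeMul (α q) (-(q.c • star (γ q))) (coeffSeq q 0 m) = coeffSeq q 0 (m + 1) := by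
  have key := sum_qbin_succ q m fun l => (Pi.single l
    ((-q.c) ^ l • (star (γ q) ^ l * α q ^ (m + 1 - l))) : ℕ → SUq2 q)
  have hG (m : ℕ) : coeffSeq q 0 m = ∑ l ∈ Finset.range (m + 1),
      (qbin q m l : ℂ) • Pi.single l ((-q.c) ^ l • (star (γ q) ^ l * α q ^ (m - l))) := by
    refine Finset.sum_congr rfl fun l _ => ?_
    rw [← Pi.single_smul, smul_smul]
    simp [qbin_zero_right]
  rw [hG, hG, key, map_sum]
  refine Finset.sum_congr rfl fun l hl => ?_
  obtain ⟨p, rfl⟩ := Nat.exists_eq_add_of_le (Nat.lt_succ_iff.1 (Finset.mem_range.1 hl))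
  have h1 : l + p - l = p := by omega
  have h2 : l + p + 1 - l = p + 1 := by omega
  have h3 : l + p + 1 - (l + 1) = p := by omega
  rw [map_smul, planeMul_single, h1, h2, h3, mul_smul_comm, mul_smul_comm, ← mul_assoc,
    mul_pow_of_smul (su_ags q), smul_mul_assoc, mul_assoc, ← pow_succ', ← Pi.single_smul, neg_mul,
    smul_mul_assoc, ← mul_assoc, ← pow_succ', ← neg_smul]
  simp only [smul_smul]
  congr 4
  ring

/-- The new factor moves past the `k` factors `γ s + α^* t`, each contributing a `q`. -/
lemma planeMul_coeffSeq_right (k m : ℕ) :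
    planeMul (α q) (-(q.c • star (γ q))) (coeffSeq q k m) = q.c ^ k • coeffSeq q k (m + 1) := by
  induction k with
  | zero => rw [planeMul_coeffSeq_zero, pow_zero, one_smul]
  | succ k ih =>
    rw [← planeMul_coeffSeq_left, planeMul_comm, ih, map_smul, planeMul_coeffSeq_left, smul_smul,
      pow_succ']

lemma coeffSeq_apply (k m j : ℕ) : coeffSeq q k m j =
    ∑ i ∈ Finset.range (k + 1), ∑ l ∈ Finset.range (m + 1), if i + l = j then
      ((qbin q k i * qbin q m l : ℝ) * q.c ^ ((k - i) * l) * (-q.c) ^ l) •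
        (star (α q) ^ i * γ q ^ (k - i) * star (γ q) ^ l * α q ^ (m - l)) else 0 := by
  rw [coeffSeq, Finset.sum_comm]
  simp only [Finset.sum_apply, Pi.single_apply, eq_comm]

lemma coeffSeq_eq_zero {k m j : ℕ} (h : k + m < j) : coeffSeq q k m j = 0 := by
  rw [coeffSeq_apply]
  refine Finset.sum_eq_zero fun i hi => Finset.sum_eq_zero fun l hl => if_neg ?_
  rw [Finset.mem_range] at hi hl
  omega

lemma T_apply (n : ℕ) (k j : Fin (n + 1)) : T q n k j =
    ((Real.sqrt (qbin q n k / qbin q n j) : ℝ) : ℂ) • coeffSeq q k (n - k) j := by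
  rw [coeffSeq_apply]
  rfl

end Coefficients

/-! ### Symmetries of the corepresentation matrices -/

section Symmetries

variable {q : Par}

/-- The adjoint of a monomial is again in the chosen order, with the roles of the two linear forms
exchanged. The term `(i, l)` on the left matches the term `(m-l, k-i)` on the right, so both sums
are reflected. -/
lemma star_coeffSeq {k m j : ℕ} (hj : j ≤ k + m) :
    (-q.c) ^ k • star (coeffSeq q k m j) = (-q.c) ^ j • coeffSeq q m k (k + m - j) := by
  rw [coeffSeq_apply, coeffSeq_apply, Finset.sum_comm, ← Finset.sum_range_reflect]
  simp only [star_sum, Finset.smul_sum]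
  refine Finset.sum_congr rfl fun l hl => ?_
  rw [← Finset.sum_range_reflect]
  refine Finset.sum_congr rfl fun i hi => ?_
  rw [Finset.mem_range] at hl hi
  obtain ⟨p, rfl⟩ := Nat.exists_eq_add_of_le (Nat.lt_succ_iff.1 hl)
  obtain ⟨r, rfl⟩ := Nat.exists_eq_add_of_le (Nat.lt_succ_iff.1 hi)
  have hreal (r : ℝ) : star (r : ℂ) = r := Complex.conj_ofReal r
  have h1 : l + p + 1 - 1 - l = p := by omega
  have h2 : i + r + 1 - 1 - i = r := by omega
  have h3 : i + r - r = i := by omega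
  have h4 : l + p - p = l := by omega
  have h5 : l + p - l = p := by omega
  have h6 : i + r - i = r := by omega
  rw [h1, h2, h3, h4, h5, h6]
  by_cases h : r + p = j
  · subst h
    have hb1 : qbin q (l + p) l = qbin q (l + p) p := by
      rw [← qbin_symm q (Nat.le_add_left p l), h4]
    have hb2 : qbin q (i + r) i = qbin q (i + r) r := by
      rw [← qbin_symm q (Nat.le_add_left r i), h3]
    rw [if_pos rfl, if_pos (by omega), star_smul, smul_smul, smul_smul, hb1, hb2]
    simp only [star_mul, star_pow, star_star, mul_assoc]
    congr 1
    simp only [Par.star_c, star_neg, hreal]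
    push_cast
    ring
  · rw [if_neg h, if_neg (by omega), star_zero, smul_zero, smul_zero]

/-- Self-conjugacy of the corepresentation: the normalizing roots survive because the `q`-binomials
are symmetric under `k ↦ n-k`. -/
lemma star_T (n : ℕ) (k j : Fin (n + 1)) :
    (-q.c) ^ (k : ℕ) • star (T q n k j) = (-q.c) ^ (j : ℕ) • T q n k.rev j.rev := by
  have hk : (k : ℕ) ≤ n := by omega
  have hj : (j : ℕ) ≤ n := by omega
  have h := star_coeffSeq (q := q) (k := k) (m := n - k) (j := j) (by omega)
  rw [T_apply, T_apply, star_smul, smul_comm, h, smul_comm]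
  simp only [Fin.val_rev, Nat.add_sub_add_right, qbin_symm q hk, qbin_symm q hj,
    ← starRingEnd_apply, Complex.conj_ofReal]
  rw [Nat.add_sub_cancel' hk, Nat.sub_sub_self hk]

/-! ### The transposing automorphism -/

variable (q) in
/-- The images of the letters under the automorphism that transposes `T^(1)`. -/
noncomputable def transposeLetter : Fin 2 ⊕ Fin 2 → SUq2 q :=
  Sum.elim ![α q, -(q.c • star (γ q))] ![star (α q), -(q.c⁻¹ • γ q)]

/-- The assignment does not respect the involution: `γ ↦ -q γ^*` while `γ^* ↦ -q⁻¹ γ`. Hence the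
adjoint relations need a separate check. -/
lemma transposeLetter_rel {a b : FreeStarAlg (Fin 2)} (h : StarClosure (SUq2Rel q) a b) :
    FreeStarAlg.liftAlg (transposeLetter q) a = FreeStarAlg.liftAlg (transposeLetter q) b := by
  have hq := q.c_ne_zero
  have hg (i : Fin 2) : FreeStarAlg.gen i = FreeStarAlg.letter (Sum.inl i) := rfl
  cases h with
  | of h =>
    cases h with
    | left i j | right i j =>
      fin_cases i <;> fin_cases j <;>
      simp [fundMatrix, Matrix.mul_apply, Fin.sum_univ_two, hg, transposeLetter,
        su_ag, su_ags, su_asg, su_asgs, su_gsg, su_asa, su_aas] <;>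
      match_scalars <;> field_simp <;> ring
  | adj h =>
    cases h with
    | left i j | right i j =>
      fin_cases i <;> fin_cases j <;>
      simp [fundMatrix, Matrix.mul_apply, Fin.sum_univ_two, hg, transposeLetter,
        su_ag, su_ags, su_asg, su_asgs, su_gsg, su_asa, su_aas] <;>
      match_scalars <;> field_simp <;> ring

variable (q) in
/-- The automorphism of the algebra `O(SU_q(2))` that transposes `T^(1)`. -/
noncomputable def transposeHom : SUq2 q →ₐ[ℂ] SUq2 q :=
  StarAlg.liftAlg (FreeStarAlg.liftAlg (transposeLetter q)) fun _ _ => transposeLetter_rel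

lemma transposeHom_letter (y : Fin 2 ⊕ Fin 2) :
    transposeHom q (StarAlg.mkAlg _ (FreeStarAlg.letter y)) = transposeLetter q y := by
  rw [transposeHom, StarAlg.liftAlg_mkAlg, FreeStarAlg.liftAlg_letter]

lemma transposeHom_α : transposeHom q (α q) = α q := transposeHom_letter (Sum.inl 0)

lemma transposeHom_γ : transposeHom q (γ q) = -(q.c • star (γ q)) := transposeHom_letter (Sum.inl 1)

lemma transposeHom_star_α : transposeHom q (star (α q)) = star (α q) := by
  have h := transposeHom_letter (q := q) (Sum.inr 0)
  rwa [show FreeStarAlg.letter (Sum.inr 0) = star (FreeStarAlg.gen (0 : Fin 2)) from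
    (FreeStarAlg.star_letter (Sum.inl 0)).symm, StarAlg.mkAlg_star] at h

lemma transposeHom_star_γ : transposeHom q (star (γ q)) = -(q.c⁻¹ • γ q) := by
  have h := transposeHom_letter (q := q) (Sum.inr 1)
  rwa [show FreeStarAlg.letter (Sum.inr 1) = star (FreeStarAlg.gen (1 : Fin 2)) from
    (FreeStarAlg.star_letter (Sum.inl 1)).symm, StarAlg.mkAlg_star] at h

lemma transposeHom_fundMatrix (i j : Fin 2) :
    transposeHom q (fundMatrix q (α q) (γ q) i j) = fundMatrix q (α q) (γ q) j i := by
  have hq := q.c_ne_zero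
  fin_cases i <;> fin_cases j <;>
    simp [fundMatrix, transposeHom_α, transposeHom_γ, transposeHom_star_α, transposeHom_star_γ,
      smul_smul, hq]

/-- Eliminating `l = j - i` leaves a range and a condition symmetric in `k` and `j`, so that `T^(n)`
can be transposed term by term. -/
lemma coeffSeq_eq_sum_range {n k : ℕ} (hk : k ≤ n) (j : ℕ) : coeffSeq q k (n - k) j =
    ∑ i ∈ Finset.range (n + 1), if i ≤ k ∧ i ≤ j ∧ k + j ≤ n + i then
      ((qbin q k i * qbin q (n - k) (j - i) : ℝ) * q.c ^ ((k - i) * (j - i)) * (-q.c) ^ (j - i)) •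
        (star (α q) ^ i * γ q ^ (k - i) * star (γ q) ^ (j - i) * α q ^ (n + i - (k + j)))
      else 0 := by
  rw [coeffSeq_apply]
  have hsub : Finset.range (k + 1) ⊆ Finset.range (n + 1) := Finset.range_mono (by omega)
  rw [← Finset.sum_subset hsub]
  · refine Finset.sum_congr rfl fun i hi => ?_
    rw [Finset.mem_range] at hi
    by_cases h : i ≤ j ∧ k + j ≤ n + i
    · rw [if_pos ⟨by omega, h.1, h.2⟩, Finset.sum_eq_single (j - i)]
      · rw [if_pos (by omega), show n - k - (j - i) = n + i - (k + j) by omega]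
      · intro l _ hl
        exact if_neg (by omega)
      · intro hl
        rw [Finset.mem_range] at hl
        omega
    · rw [if_neg (by tauto)]
      refine Finset.sum_eq_zero fun l hl => if_neg ?_
      rw [Finset.mem_range] at hl
      omega
  · intro i _ hi
    rw [Finset.mem_range] at hi
    exact if_neg (by omega)

/-- For `a = k-i`, `b = j-i`, `c = n+i-k-j`, both `[n,k] [k,i] [n-k,j-i]` and `[n,j] [j,i]
[n-j,k-i]` equal the `q`-multinomial of `(i, a, b, c)`. Dividing by `([n,k] [n,j])^(1/2)` gives the
claim. -/
lemma sqrt_qbin_mul {n k j i : ℕ} (hk : k ≤ n) (hj : j ≤ n) (hik : i ≤ k) (hij : i ≤ j)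
    (h : k + j ≤ n + i) :
    Real.sqrt (qbin q n k / qbin q n j) * (qbin q k i * qbin q (n - k) (j - i)) =
      Real.sqrt (qbin q n j / qbin q n k) * (qbin q j i * qbin q (n - j) (k - i)) := by
  obtain ⟨a, rfl⟩ := Nat.exists_eq_add_of_le hik
  obtain ⟨b, rfl⟩ := Nat.exists_eq_add_of_le hij
  obtain ⟨c, hc⟩ := Nat.exists_eq_add_of_le h
  obtain rfl : n = i + a + b + c := by omega
  have h1 := qbin_add q i a
  have h2 := qbin_add q i b
  have h3 := qbin_add q b c
  have h4 := qbin_add q a c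
  have h5 := qbin_add q (i + a) (b + c)
  have h6 := qbin_add q (i + b) (a + c)
  have e1 : i + a + b + c = i + a + (b + c) := by omega
  have e2 : i + a + b + c = i + b + (a + c) := by omega
  have e3 : i + a + b + c - (i + a) = b + c := by omega
  have e4 : i + a + b + c - (i + b) = a + c := by omega
  rw [← e1] at h5
  rw [← e2] at h6
  have p1 := qbin_pos q (i + a) (b + c)
  have p2 := qbin_pos q (i + b) (a + c)
  rw [← e1] at p1
  rw [← e2] at p2
  rw [e3, e4, Nat.add_sub_cancel_left, Nat.add_sub_cancel_left]
  have key : qbin q (i + a + b + c) (i + a) * (qbin q (i + a) i * qbin q (b + c) b) =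
      qbin q (i + a + b + c) (i + b) * (qbin q (i + b) i * qbin q (a + c) a) := by
    rw [h1, h2, h3, h4, h5, h6]
    have := (qfac_pos q i).ne'
    have := (qfac_pos q a).ne'
    have := (qfac_pos q b).ne'
    have := (qfac_pos q c).ne'
    have := (qfac_pos q (i + a)).ne'
    have := (qfac_pos q (i + b)).ne'
    have := (qfac_pos q (b + c)).ne'
    have := (qfac_pos q (a + c)).ne'
    field_simp
  generalize qbin q (i + a + b + c) (i + a) = A at *
  generalize qbin q (i + a + b + c) (i + b) = B at *
  have hA := (Real.sqrt_pos.2 p1).ne'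
  have hB := (Real.sqrt_pos.2 p2).ne'
  rw [Real.sqrt_div p1.le, Real.sqrt_div p2.le]
  rw [← Real.mul_self_sqrt p1.le, ← Real.mul_self_sqrt p2.le] at key
  field_simp
  linear_combination key

lemma transposeHom_T (n : ℕ) (k j : Fin (n + 1)) : transposeHom q (T q n k j) = T q n j k := by
  have hk : (k : ℕ) ≤ n := by omega
  have hj : (j : ℕ) ≤ n := by omega
  have hq := q.c_ne_zero
  have hc : star (γ q) * γ q = γ q * star (γ q) := su_gsg q
  rw [T_apply, T_apply, coeffSeq_eq_sum_range hk, coeffSeq_eq_sum_range hj, map_smul, map_sum,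
    Finset.smul_sum, Finset.smul_sum]
  refine Finset.sum_congr rfl fun i _ => ?_
  by_cases h : i ≤ (k : ℕ) ∧ i ≤ (j : ℕ) ∧ (k : ℕ) + j ≤ n + i
  · rw [if_pos h, if_pos ⟨h.2.1, h.1, by omega⟩, map_smul, smul_smul, smul_smul]
    simp only [map_mul, map_pow, transposeHom_α, transposeHom_γ, transposeHom_star_α,
      transposeHom_star_γ, ← neg_smul, smul_pow, smul_mul_assoc, mul_smul_comm, smul_smul]
    have hcomm := (Commute.pow_pow hc (k - i : ℕ) (j - i : ℕ)).eq
    rw [mul_assoc (star (α q) ^ i), hcomm, ← mul_assoc (star (α q) ^ i), add_comm (k : ℕ)]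
    congr 1
    have hs := congrArg (fun r : ℝ => (r : ℂ)) (sqrt_qbin_mul (q := q) hk hj h.1 h.2.1 h.2.2)
    -- The factor coming from the images of `γ^*` cancels the `(-q)^(j-i)` of the original term; the
    -- images of `γ` supply the `(-q)^(k-i)` of the transposed term.
    have hqq : (-q.c) ^ ((j : ℕ) - i) * (-q.c⁻¹) ^ ((j : ℕ) - i) = 1 := by
      rw [← mul_pow, neg_mul_neg, mul_inv_cancel₀ hq, one_pow]
    simp only [Complex.ofReal_mul] at hs ⊢
    rw [mul_comm ((k : ℕ) - i)]
    generalize (-q.c) ^ ((j : ℕ) - i) = X at *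
    generalize (-q.c⁻¹) ^ ((j : ℕ) - i) = Y at *
    linear_combination q.c ^ (((j : ℕ) - i) * (k - i)) * (-q.c) ^ ((k : ℕ) - i) * hs +
      (Real.sqrt (qbin q n k / qbin q n j) : ℂ) * qbin q k i * qbin q (n - k) (j - i) *
        q.c ^ (((j : ℕ) - i) * (k - i)) * (-q.c) ^ ((k : ℕ) - i) * hqq
  · rw [if_neg h, if_neg (by omega), map_zero, smul_zero, smul_zero]

end Symmetries

/-! ### The embedding of `V_(n+1)` into `V_1 ⊗ V_n` -/

section Embedding

variable (q : Par) (n : ℕ)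

/-- The matrix of the isometric embedding `V_(n+1) → V_1 ⊗ V_n` of corepresentations. -/
noncomputable def embCoeff : Matrix (Fin 2 × Fin (n + 1)) (Fin (n + 1 + 1)) ℝ :=
  Matrix.of fun p k =>
    if p.1 = 0 then
      if k = p.2.castSucc then
        (Real.sqrt (qnum q (n + 1)))⁻¹ * ((q : ℝ) ^ (k : ℕ) * Real.sqrt (qnum q (n + 1 - k)))
      else 0
    else
      if k = p.2.succ then (Real.sqrt (qnum q (n + 1)))⁻¹ * Real.sqrt (qnum q k) else 0

lemma embCoeff_zero (d : Fin (n + 1)) (k : Fin (n + 1 + 1)) : embCoeff q n (0, d) k =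
    if k = d.castSucc then
      (Real.sqrt (qnum q (n + 1)))⁻¹ * ((q : ℝ) ^ (k : ℕ) * Real.sqrt (qnum q (n + 1 - k)))
    else 0 := rfl

lemma embCoeff_one (d : Fin (n + 1)) (k : Fin (n + 1 + 1)) : embCoeff q n (1, d) k =
    if k = d.succ then (Real.sqrt (qnum q (n + 1)))⁻¹ * Real.sqrt (qnum q k) else 0 := rfl

/-- The matrix of the embedding `V_(n+1) → V_1 ⊗ V_n` over a complex algebra. -/
noncomputable def embMatrix (R : Type) [Ring R] [Algebra ℂ R] :
    Matrix (Fin 2 × Fin (n + 1)) (Fin (n + 1 + 1)) R :=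
  (embCoeff q n).map fun r => algebraMap ℂ R (r : ℂ)

/-- Each row has at most one nonzero entry, so distinct columns are orthogonal. The squared norm of
column `k` is `(q^(2k) [n+1-k] + [k]) / [n+1] = 1`. -/
lemma embCoeff_isometry : (embCoeff q n)ᵀ * embCoeff q n = 1 := by
  have hn := Real.mul_self_sqrt (qnum_nonneg q (n + 1))
  have hn' := (Real.sqrt_pos.2 (qnum_succ_pos q n)).ne'
  have hne : ∀ a : Fin (n + 1), a.castSucc ≠ Fin.last (n + 1) := fun a => a.castSucc_lt_last.ne
  ext j k
  rw [Matrix.mul_apply, Fintype.sum_prod_type, Fin.sum_univ_two]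
  simp only [Matrix.transpose_apply, embCoeff_zero, embCoeff_one]
  by_cases hjk : j = k
  · subst hjk
    have hs : (∑ d : Fin (n + 1), (if j = d.castSucc then (Real.sqrt (qnum q (n + 1)))⁻¹ *
        ((q : ℝ) ^ (j : ℕ) * Real.sqrt (qnum q (n + 1 - j))) else 0) *
        (if j = d.castSucc then (Real.sqrt (qnum q (n + 1)))⁻¹ *
        ((q : ℝ) ^ (j : ℕ) * Real.sqrt (qnum q (n + 1 - j))) else 0)) =
        (Real.sqrt (qnum q (n + 1)))⁻¹ * (Real.sqrt (qnum q (n + 1)))⁻¹ *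
          ((q : ℝ) ^ (2 * (j : ℕ)) * qnum q (n + 1 - j)) := by
      rw [← Real.mul_self_sqrt (qnum_nonneg q (n + 1 - j))]
      induction j using Fin.lastCases with
      -- The last column has no entry with first index 0, in agreement with `[0] = 0`.
      | last => simp [(hne _).symm, qnum_zero]
      | cast j => simp [Fin.castSucc_inj]; ring
    have ht : (∑ d : Fin (n + 1), (if j = d.succ then (Real.sqrt (qnum q (n + 1)))⁻¹ *
        Real.sqrt (qnum q j) else 0) * (if j = d.succ then (Real.sqrt (qnum q (n + 1)))⁻¹ *
        Real.sqrt (qnum q j) else 0)) =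
        (Real.sqrt (qnum q (n + 1)))⁻¹ * (Real.sqrt (qnum q (n + 1)))⁻¹ * qnum q j := by
      rw [← Real.mul_self_sqrt (qnum_nonneg q j)]
      induction j using Fin.cases with
      | zero => simp [(Fin.succ_ne_zero _).symm, qnum_zero]
      | succ j => simp [Fin.succ_inj]; ring
    rw [hs, ht, ← mul_add, qnum_add, Nat.add_sub_cancel' (by omega), Matrix.one_apply_eq, ← mul_inv,
      hn, inv_mul_cancel₀ (qnum_succ_pos q n).ne']
  · rw [Matrix.one_apply_ne hjk, Finset.sum_eq_zero, Finset.sum_eq_zero, add_zero]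
    · intro d _
      by_cases h : j = d.succ
      · rw [if_neg (fun h' : k = d.succ => hjk (h.trans h'.symm)), mul_zero]
      · rw [if_neg h, zero_mul]
    · intro d _
      by_cases h : j = d.castSucc
      · rw [if_neg (fun h' : k = d.castSucc => hjk (h.trans h'.symm)), mul_zero]
      · rw [if_neg h, zero_mul]

lemma sqrt_ratio {A B x y : ℝ} (hA : 0 ≤ A) (hB : 0 ≤ B) :
    (Real.sqrt A)⁻¹ * Real.sqrt B * Real.sqrt (x / y) = Real.sqrt (B * x / (A * y)) := by
  rw [← Real.sqrt_inv, ← Real.sqrt_mul (inv_nonneg.2 hA), ← Real.sqrt_mul (mul_nonneg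
    (inv_nonneg.2 hA) hB)]
  congr 1
  rw [div_eq_mul_inv, div_eq_mul_inv, mul_inv]
  ring

variable {n} {q}

lemma qnum_qbin_cast (j : Fin (n + 1)) :
    qnum q (n + 1) * qbin q n j = qnum q (n + 1 - j) * qbin q (n + 1) j := by
  obtain ⟨m, hm⟩ := Nat.exists_eq_add_of_le (Nat.lt_succ_iff.1 j.2)
  have h := qnum_mul_qbin_left q j m
  rwa [← hm, show m + 1 = n + 1 - j by omega] at h

lemma qnum_qbin_succ (j : Fin (n + 1)) :
    qnum q (n + 1) * qbin q n j = qnum q (j + 1) * qbin q (n + 1) (j + 1) := by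
  obtain ⟨m, hm⟩ := Nat.exists_eq_add_of_le (Nat.lt_succ_iff.1 j.2)
  have h := qnum_mul_qbin_right q j m
  rwa [← hm] at h

/-- Here and in the next three lemmas a single term of the sum can survive, and its square roots
combine to the same factor `([n,d] / [n+1,j])^(1/2)`. The intertwining relation is thus reduced to
one between unnormalized coefficients. -/
lemma sum_embCoeff_zero_smul_T (d : Fin (n + 1)) (j : Fin (n + 1 + 1)) :
    ∑ b, (embCoeff q n (0, b) j : ℂ) • T q n d b =
      (Real.sqrt (qbin q n d / qbin q (n + 1) j) : ℂ) •
        q.c ^ (j : ℕ) • coeffSeq q d (n - d) j := by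
  have hne : ∀ a : Fin (n + 1), a.castSucc ≠ Fin.last (n + 1) := fun a => a.castSucc_lt_last.ne
  induction j using Fin.lastCases with
  | last =>
    rw [coeffSeq_eq_zero (by simp; omega), smul_zero, smul_zero]
    exact Finset.sum_eq_zero fun b _ => by rw [embCoeff_zero, if_neg (hne b).symm]; simp
  | cast j =>
    rw [Finset.sum_eq_single j]
    · have h := sqrt_ratio (x := qbin q n d) (y := qbin q n j) (qnum_nonneg q (n + 1))
        (qnum_nonneg q (n + 1 - j))
      rw [qnum_qbin_cast, mul_div_mul_left _ _ (by
        rw [show n + 1 - (j : ℕ) = n - j + 1 by omega]; exact (qnum_succ_pos q _).ne')] at h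
      rw [embCoeff_zero, if_pos rfl, T_apply, smul_smul, smul_smul, Fin.val_castSucc, ← h]
      push_cast
      rw [show ((q : ℝ) : ℂ) = q.c from rfl]
      congr 1
      ring
    · intro b _ hb
      rw [embCoeff_zero, if_neg (fun h => hb (Fin.castSucc_injective _ h).symm), Complex.ofReal_zero,
        zero_smul]
    · simp

lemma sum_embCoeff_one_smul_T (d : Fin (n + 1)) (j : Fin (n + 1 + 1)) :
    ∑ b, (embCoeff q n (1, b) j : ℂ) • T q n d b =
      (Real.sqrt (qbin q n d / qbin q (n + 1) j) : ℂ) • shift (coeffSeq q d (n - d)) j := by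
  induction j using Fin.cases with
  | zero =>
    rw [Fin.val_zero, shift, smul_zero]
    exact Finset.sum_eq_zero fun b _ => by
      rw [embCoeff_one, if_neg (Fin.succ_ne_zero b).symm, Complex.ofReal_zero, zero_smul]
  | succ j =>
    rw [Finset.sum_eq_single j]
    · have h := sqrt_ratio (x := qbin q n d) (y := qbin q n j) (qnum_nonneg q (n + 1))
        (qnum_nonneg q (j + 1))
      rw [qnum_qbin_succ, mul_div_mul_left _ _ (qnum_succ_pos q _).ne'] at h
      rw [embCoeff_one, if_pos rfl, T_apply, smul_smul, Fin.val_succ, ← h, shift]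
      simp only [Complex.ofReal_mul]
    · intro b _ hb
      rw [embCoeff_one, if_neg (fun h => hb (Fin.succ_injective _ h).symm), Complex.ofReal_zero,
        zero_smul]
    · simp

lemma sum_embCoeff_smul_T_zero (d : Fin (n + 1)) (j : Fin (n + 1 + 1)) :
    ∑ k, (embCoeff q n (0, d) k : ℂ) • T q (n + 1) k j =
      (Real.sqrt (qbin q n d / qbin q (n + 1) j) : ℂ) •
        q.c ^ (d : ℕ) • coeffSeq q d (n - d + 1) j := by
  rw [Finset.sum_eq_single d.castSucc]
  · have h := sqrt_ratio (x := qbin q (n + 1) d) (y := qbin q (n + 1) j) (qnum_nonneg q (n + 1))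
      (qnum_nonneg q (n + 1 - d))
    rw [← qnum_qbin_cast, mul_div_mul_left _ _ (qnum_succ_pos q _).ne'] at h
    rw [embCoeff_zero, if_pos rfl, T_apply, smul_smul, smul_smul, Fin.val_castSucc, ← h,
      show n + 1 - (d : ℕ) = n - d + 1 by omega]
    push_cast
    rw [show ((q : ℝ) : ℂ) = q.c from rfl]
    congr 1
    ring
  · intro k _ hk
    rw [embCoeff_zero, if_neg hk, Complex.ofReal_zero, zero_smul]
  · simp

lemma sum_embCoeff_smul_T_one (d : Fin (n + 1)) (j : Fin (n + 1 + 1)) :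
    ∑ k, (embCoeff q n (1, d) k : ℂ) • T q (n + 1) k j =
      (Real.sqrt (qbin q n d / qbin q (n + 1) j) : ℂ) • coeffSeq q (d + 1) (n - d) j := by
  rw [Finset.sum_eq_single d.succ]
  · have h := sqrt_ratio (x := qbin q (n + 1) (d + 1)) (y := qbin q (n + 1) j)
      (qnum_nonneg q (n + 1)) (qnum_nonneg q (d + 1))
    rw [← qnum_qbin_succ, mul_div_mul_left _ _ (qnum_succ_pos q _).ne'] at h
    rw [embCoeff_one, if_pos rfl, T_apply, smul_smul, Fin.val_succ, ← h, Nat.add_sub_add_right]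
    simp only [Complex.ofReal_mul]
  · intro k _ hk
    rw [embCoeff_one, if_neg hk, Complex.ofReal_zero, zero_smul]
  · simp

variable (n) (q)

/-- `T^(1) ⊗ T^(n)` restricts to `T^(n+1)` on the image of the embedding. -/
lemma kronecker_mul_embMatrix :
    (fundMatrix q (α q) (γ q) ⊗ₖ T q n) * embMatrix q n (SUq2 q) =
      embMatrix q n (SUq2 q) * T q (n + 1) := by
  ext ⟨c, d⟩ j
  have hl : ((fundMatrix q (α q) (γ q) ⊗ₖ T q n) * embMatrix q n (SUq2 q)) (c, d) j =
      ∑ a, fundMatrix q (α q) (γ q) c a * ∑ b, (embCoeff q n (a, b) j : ℂ) • T q n d b := by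
    rw [Matrix.mul_apply, Fintype.sum_prod_type]
    refine Finset.sum_congr rfl fun a _ => ?_
    rw [Finset.mul_sum]
    refine Finset.sum_congr rfl fun b _ => ?_
    rw [Matrix.kronecker_apply, embMatrix, Matrix.map_apply, ← Algebra.commutes, ← Algebra.smul_def,
      mul_smul_comm]
  have hr : (embMatrix q n (SUq2 q) * T q (n + 1)) (c, d) j =
      ∑ k, (embCoeff q n (c, d) k : ℂ) • T q (n + 1) k j := by
    rw [Matrix.mul_apply]
    refine Finset.sum_congr rfl fun k _ => ?_
    rw [embMatrix, Matrix.map_apply, ← Algebra.smul_def]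
  rw [hl, hr, Fin.sum_univ_two, sum_embCoeff_zero_smul_T, sum_embCoeff_one_smul_T, mul_smul_comm,
    mul_smul_comm, mul_smul_comm, ← smul_add]
  -- The factor `q^j` in the embedding is the one produced by `s` passing `t^j`.
  have h (a b : SUq2 q) : q.c ^ (j : ℕ) • (a * coeffSeq q d (n - d) j) +
      b * shift (coeffSeq q d (n - d)) j = planeMul a b (coeffSeq q d (n - d)) j := rfl
  rw [h]
  fin_cases c
  · refine Eq.trans ?_ (sum_embCoeff_smul_T_zero d j).symm
    exact congrArg _ (congrFun (planeMul_coeffSeq_right d (n - d)) j)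
  · refine Eq.trans ?_ (sum_embCoeff_smul_T_one d j).symm
    exact congrArg _ (congrFun (planeMul_coeffSeq_left d (n - d)) j)

section Star

variable (R : Type) [Ring R] [Algebra ℂ R] [StarRing R] [StarModule ℂ R]

lemma embMatrix_conjTranspose_apply (k : Fin (n + 1 + 1)) (p : Fin 2 × Fin (n + 1)) :
    (embMatrix q n R)ᴴ k p = embMatrix q n R p k := by
  rw [Matrix.conjTranspose_apply, embMatrix, Matrix.map_apply, ← algebraMap_star_comm,
    ← starRingEnd_apply, Complex.conj_ofReal]

lemma embMatrix_isometry : (embMatrix q n R)ᴴ * embMatrix q n R = 1 := by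
  have h := congrArg (fun M => M.map ((algebraMap ℂ R).comp Complex.ofRealHom))
    (embCoeff_isometry q n)
  simp only [Matrix.map_mul] at h
  rw [Matrix.map_one _ (map_zero _) (map_one _)] at h
  rw [← h]
  congr 1
  ext k p
  rw [embMatrix_conjTranspose_apply]
  rfl

end Star

/-- The transposing automorphism is applied entrywise to the intertwining relation. It preserves the
order of products, and the entries of `C` are scalars, hence fixed and central. -/
lemma T_mul_embMatrix_conjTranspose :
    T q (n + 1) * (embMatrix q n (SUq2 q))ᴴ =
      (embMatrix q n (SUq2 q))ᴴ * (fundMatrix q (α q) (γ q) ⊗ₖ T q n) := by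
  ext j p
  have h := congrArg (transposeHom q) (congrFun (congrFun (kronecker_mul_embMatrix q n) p) j)
  have hC (p k) : transposeHom q (embMatrix q n (SUq2 q) p k) = embMatrix q n (SUq2 q) p k :=
    AlgHom.commutes _ _
  have hcomm (p k) (z : SUq2 q) :
      embMatrix q n (SUq2 q) p k * z = z * embMatrix q n (SUq2 q) p k :=
    Algebra.commutes (embCoeff q n p k : ℂ) z
  simp only [Matrix.mul_apply, map_sum, map_mul, Matrix.kroneckerMap_apply, transposeHom_T,
    transposeHom_fundMatrix, hC] at h
  simp only [Matrix.mul_apply, embMatrix_conjTranspose_apply, Matrix.kroneckerMap_apply]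
  simp only [hcomm] at h ⊢
  exact h.symm

end Embedding

/-! ### Isometries over noncommutative rings -/

section Isometries

variable {R : Type*} [Ring R] [StarRing R] {l m l' m' : Type*}

/-- The adjoint reverses products, so the two entries of `A` stand side by side inside those of `B`.
Summing over the rows of `A` first leaves a scalar 0 or 1, and no commutation between entries is
needed. -/
lemma kronecker_isometry [Fintype l] [Fintype l'] [DecidableEq m] [DecidableEq m']
    {A : Matrix l m R} {B : Matrix l' m' R} (hA : Aᴴ * A = 1)
    (hB : Bᴴ * B = 1) : (A ⊗ₖ B)ᴴ * (A ⊗ₖ B) = 1 := by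
  ext ⟨i, j⟩ ⟨i', j'⟩
  have hA' := congrFun (congrFun hA i) i'
  have hB' := congrFun (congrFun hB j) j'
  simp only [Matrix.mul_apply, Matrix.conjTranspose_apply] at hA' hB'
  have h (a : l) (b : l') : star (A a i * B b j) * (A a i' * B b j') =
      star (B b j) * (star (A a i) * A a i') * B b j' := by
    rw [star_mul]; simp only [mul_assoc]
  simp only [Matrix.mul_apply, Matrix.conjTranspose_apply, Matrix.kronecker_apply,
    Fintype.sum_prod_type, h]
  rw [Finset.sum_comm]
  simp only [← Finset.sum_mul, ← Finset.mul_sum, hA', Matrix.one_apply, Prod.mk.injEq]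
  by_cases hi : i = i'
  · simp [hi, hB', Matrix.one_apply]
  · simp [hi]

/-- Here the entries of `B` are the inner pair, so they are summed first. -/
lemma kronecker_coisometry [Fintype m] [Fintype m'] [DecidableEq l] [DecidableEq l']
    {A : Matrix l m R} {B : Matrix l' m' R} (hA : A * Aᴴ = 1)
    (hB : B * Bᴴ = 1) : (A ⊗ₖ B) * (A ⊗ₖ B)ᴴ = 1 := by
  ext ⟨i, j⟩ ⟨i', j'⟩
  have hA' := congrFun (congrFun hA i) i'
  have hB' := congrFun (congrFun hB j) j'
  simp only [Matrix.mul_apply, Matrix.conjTranspose_apply] at hA' hB'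
  have h (a : m) (b : m') : A i a * B j b * star (A i' a * B j' b) =
      A i a * (B j b * star (B j' b)) * star (A i' a) := by
    rw [star_mul]; simp only [mul_assoc]
  simp only [Matrix.mul_apply, Matrix.conjTranspose_apply, Matrix.kronecker_apply,
    Fintype.sum_prod_type, h]
  simp only [← Finset.sum_mul, ← Finset.mul_sum, hB', Matrix.one_apply, Prod.mk.injEq]
  by_cases hj : j = j'
  · simp [hj, hA', Matrix.one_apply]
  · simp [hj]

end Isometries

/-! ### Coisometry of the corepresentation matrices -/

lemma T_zero (q : Par) : T q 0 = 1 := by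
  ext k j
  fin_cases k
  fin_cases j
  simp [T, qbin]

/-- Inserting `C^* C = 1` between `T` and `T^*` and moving `T` past `C^*` reduces the claim to
`T^(1) ⊗ T^(n)`. -/
lemma T_coisometry (q : Par) (n : ℕ) : T q n * (T q n)ᴴ = 1 := by
  induction n with
  | zero => simp [T_zero]
  | succ n ih =>
    have hC := embMatrix_isometry q n (SUq2 q)
    have hW := kronecker_coisometry (A := fundMatrix q (α q) (γ q)) (B := T q n)
      (by ext i j; exact su_right q i j) ih
    have h := T_mul_embMatrix_conjTranspose q n
    have h' := congrArg Matrix.conjTranspose h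
    rw [Matrix.conjTranspose_mul, Matrix.conjTranspose_mul, Matrix.conjTranspose_conjTranspose] at h'
    calc T q (n + 1) * (T q (n + 1))ᴴ
        = T q (n + 1) * ((embMatrix q n (SUq2 q))ᴴ * embMatrix q n (SUq2 q)) * (T q (n + 1))ᴴ := by
          rw [hC, Matrix.mul_one]
      _ = (T q (n + 1) * (embMatrix q n (SUq2 q))ᴴ) *
            (embMatrix q n (SUq2 q) * (T q (n + 1))ᴴ) := by simp only [Matrix.mul_assoc]
      _ = (embMatrix q n (SUq2 q))ᴴ * ((fundMatrix q (α q) (γ q) ⊗ₖ T q n) *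
            (fundMatrix q (α q) (γ q) ⊗ₖ T q n)ᴴ) * embMatrix q n (SUq2 q) := by
          rw [h, h']; simp only [Matrix.mul_assoc]
      _ = 1 := by rw [hW, Matrix.mul_one, hC]

/-! ### The matrices `U^(n)` -/

section Columns

variable (q : Par) (n : ℕ)

lemma sum_embCoeff_zero_smul {M : Type*} [AddCommGroup M] [Module ℂ M] (X : Fin (n + 1) → M)
    (k : Fin (n + 1 + 1)) : ∑ d, (embCoeff q n (0, d) k : ℂ) • X d =
      ((Real.sqrt (qnum q (n + 1)))⁻¹ : ℂ) •
        (q.c ^ (k : ℕ) * ((Real.sqrt (qnum q (n + 1 - k)) : ℝ) : ℂ)) •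
          if h : (k : ℕ) < n + 1 then X ⟨k, h⟩ else 0 := by
  by_cases h : (k : ℕ) < n + 1
  · rw [Finset.sum_eq_single ⟨k, h⟩]
    · rw [dif_pos h, embCoeff_zero, if_pos (show k = Fin.castSucc ⟨k, h⟩ from rfl), smul_smul]
      push_cast
      rfl
    · intro d _ hd
      rw [embCoeff_zero, if_neg (fun h' => hd (Fin.ext (by simp [h']))), Complex.ofReal_zero,
        zero_smul]
    · simp
  · rw [dif_neg h, smul_zero, smul_zero]
    refine Finset.sum_eq_zero fun d _ => ?_
    rw [embCoeff_zero, if_neg (fun h' : k = d.castSucc => h (h' ▸ d.2)), Complex.ofReal_zero, zero_smul]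

lemma sum_embCoeff_one_smul {M : Type*} [AddCommGroup M] [Module ℂ M] (X : Fin (n + 1) → M)
    (k : Fin (n + 1 + 1)) : ∑ d, (embCoeff q n (1, d) k : ℂ) • X d =
      ((Real.sqrt (qnum q (n + 1)))⁻¹ : ℂ) • ((Real.sqrt (qnum q k) : ℝ) : ℂ) •
          if h : 0 < (k : ℕ) then X ⟨k - 1, by omega⟩ else 0 := by
  by_cases h : 0 < (k : ℕ)
  · have hk : k = Fin.succ ⟨(k : ℕ) - 1, by omega⟩ := Fin.ext (by simp; omega)
    rw [Finset.sum_eq_single ⟨(k : ℕ) - 1, by omega⟩]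
    · rw [dif_pos h, embCoeff_one, if_pos hk, smul_smul]
      push_cast
      rfl
    · intro d _ hd
      rw [embCoeff_one, if_neg (fun h' => hd (Fin.ext (by simp [h']))), Complex.ofReal_zero,
        zero_smul]
    · simp
  · rw [dif_neg h, smul_zero, smul_zero]
    refine Finset.sum_eq_zero fun d _ => ?_
    rw [embCoeff_one, if_neg (fun h' => h (by simp [h'])), Complex.ofReal_zero, zero_smul]

lemma U_succ : U q (n + 1) = ((u q ⊗ₖ U q n) * embMatrix q n (S7 q)).submatrix
    (Fin.consEquiv fun _ : Fin (n + 1) => Fin 4).symm id := by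
  ext I k
  have hr : ((u q ⊗ₖ U q n) * embMatrix q n (S7 q)).submatrix
      (Fin.consEquiv fun _ : Fin (n + 1) => Fin 4).symm id I k =
        ∑ a, u q (I 0) a * ∑ b, (embCoeff q n (a, b) k : ℂ) • U q n (Fin.tail I) b := by
    rw [Matrix.submatrix_apply, Matrix.mul_apply, Fintype.sum_prod_type]
    refine Finset.sum_congr rfl fun a _ => ?_
    rw [Finset.mul_sum]
    refine Finset.sum_congr rfl fun b _ => ?_
    rw [Matrix.kronecker_apply, embMatrix, Matrix.map_apply, ← Algebra.commutes, ← Algebra.smul_def,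
      mul_smul_comm]
    rfl
  rw [hr, Fin.sum_univ_two, sum_embCoeff_zero_smul, sum_embCoeff_one_smul]
  rcases n with _ | n
  -- With `U^(0) = 1`, the values `[0] = 0` and `[1] = 1` make the recursion produce `U^(1) = u`.
  · fin_cases k <;> simp [U, qnum_zero, qnum_one]
  · simp only [mul_smul_comm, ← smul_add, U, Matrix.of_apply, Complex.ofReal_inv]

/-- The two sphere relations give the diagonal entries, the first for column 0 and the second for
column 1; the commutation relations do the rest. -/
lemma u_isometry : (u q)ᴴ * u q = 1 := by
  have hq := q.c_ne_zero
  ext i j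
  fin_cases i <;> fin_cases j <;>
  simp only [Matrix.mul_apply, Fin.sum_univ_four, Matrix.conjTranspose_apply] <;>
  simp [u, s11, s12, s22, s33, s34, s21, s43, x44, s44, smul_smul] <;>
  match_scalars <;> field_simp <;> ring

lemma U_isometry : (U q n)ᴴ * U q n = 1 := by
  induction n with
  | zero =>
    ext i j
    fin_cases i
    fin_cases j
    simp [U, Matrix.mul_apply]
  | succ n ih =>
    have hW := kronecker_isometry (u_isometry q) ih
    rw [U_succ, Matrix.conjTranspose_submatrix, Matrix.submatrix_mul_equiv,
      Matrix.conjTranspose_mul, Matrix.mul_assoc, ← Matrix.mul_assoc _ (u q ⊗ₖ U q n), hW,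
      Matrix.one_mul, embMatrix_isometry, Matrix.submatrix_id_id]

lemma map_mul_algHom {R S l m p : Type*} [Ring R] [Ring S] [Algebra ℂ R] [Algebra ℂ S] [Fintype m]
    (f : R →ₐ[ℂ] S) (A : Matrix l m R) (B : Matrix m p R) : (A * B).map f = A.map f * B.map f := by
  ext i j
  simp [Matrix.mul_apply]

lemma embMatrix_map {R S : Type} [Ring R] [Ring S] [Algebra ℂ R] [Algebra ℂ S] (f : R →ₐ[ℂ] S) :
    (embMatrix q n R).map f = embMatrix q n S := by
  ext p k
  exact AlgHom.commutes f _

/-! ### Algebra of the dotted tensor product -/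

section DotTensor

variable {A H : Type} [Ring A] [Algebra ℂ A] [Ring H] [Algebra ℂ H] {l m p l' m' p' : Type}
  [Fintype m] [Fintype m']

lemma dotTensor_eq_mul (a : Matrix l m A) (b : Matrix m p H) : dotTensor a b =
    a.map (Algebra.TensorProduct.includeLeft : A →ₐ[ℂ] A ⊗[ℂ] H) *
      b.map (Algebra.TensorProduct.includeRight : H →ₐ[ℂ] A ⊗[ℂ] H) := by
  ext i j
  simp [dotTensor, Matrix.mul_apply]

lemma dotTensor_kronecker (a : Matrix l m A) (b : Matrix m p H) (c : Matrix l' m' A)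
    (d : Matrix m' p' H) :
    dotTensor a b ⊗ₖ dotTensor c d = dotTensor (a ⊗ₖ c) (b ⊗ₖ d) := by
  ext ⟨i, i'⟩ ⟨j, j'⟩
  simp [dotTensor, Fintype.sum_prod_type, Finset.sum_mul_sum]

lemma dotTensor_mul_right (a : Matrix l m A) (b : Matrix m m' H) (c : Matrix m' p H) :
    dotTensor a (b * c) = dotTensor a b *
      c.map (Algebra.TensorProduct.includeRight : H →ₐ[ℂ] A ⊗[ℂ] H) := by
  rw [dotTensor_eq_mul, dotTensor_eq_mul, map_mul_algHom, Matrix.mul_assoc]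

/-- Scalar entries move across the tensor sign. -/
lemma dotTensor_embMatrix_mul (a : Matrix l (Fin 2 × Fin (n + 1)) A)
    (c : Matrix (Fin (n + 1 + 1)) p H) :
    dotTensor (a * embMatrix q n A) c = dotTensor a (embMatrix q n H * c) := by
  rw [dotTensor_eq_mul, dotTensor_eq_mul, map_mul_algHom, map_mul_algHom, embMatrix_map,
    embMatrix_map, Matrix.mul_assoc]

end DotTensor

lemma coaction_U : (U q n).map (coaction q) = dotTensor (U q n) (T q n) := by
  induction n with
  | zero =>
    ext i j
    fin_cases j
    simp [U, dotTensor, T_zero, Algebra.TensorProduct.one_def]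
  | succ n ih =>
    have hk : ((u q ⊗ₖ U q n) * embMatrix q n (S7 q)).map (coaction q) =
        dotTensor ((u q ⊗ₖ U q n) * embMatrix q n (S7 q)) (T q (n + 1)) := by
      calc ((u q ⊗ₖ U q n) * embMatrix q n (S7 q)).map (coaction q)
          = (u q ⊗ₖ U q n).map (coaction q) * (embMatrix q n (S7 q)).map (coaction q) :=
            map_mul_algHom (coaction q).toAlgHom _ _
        _ = ((u q).map (coaction q) ⊗ₖ (U q n).map (coaction q)) *
              embMatrix q n (S7 q ⊗[ℂ] SUq2 q) := by
            congr 1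
            · ext i j
              simp
            · exact embMatrix_map q n (coaction q).toAlgHom
        _ = _ := by
            rw [coaction_u, ih, dotTensor_kronecker, dotTensor_embMatrix_mul,
              ← kronecker_mul_embMatrix, dotTensor_mul_right, embMatrix_map]
    rw [U_succ]
    ext I k
    exact congrFun (congrFun hk _) k

end Columns

/-! ### Rows that transform with the corepresentation -/

section Rows

variable {q : Par} {n : ℕ}

lemma coaction_U_apply (I : Fin n → Fin 4) (j : Fin (n + 1)) :
    coaction q (U q n I j) = ∑ i, U q n I i ⊗ₜ[ℂ] T q n i j :=
  congrFun (congrFun (coaction_U q n) I) j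

/-- Rows that transform with `T^(n)` pair with columns that transform with the adjoint of `T^(n)`
to coinvariant elements. -/
lemma sum_mul_mem_S4 {v w : Fin (n + 1) → S7 q}
    (hv : ∀ k, coaction q (v k) = ∑ i, v i ⊗ₜ[ℂ] T q n i k)
    (hw : ∀ k, coaction q (w k) = ∑ i, w i ⊗ₜ[ℂ] star (T q n i k)) :
    ∑ k, v k * w k ∈ S4 q := by
  have hT (a b : Fin (n + 1)) :
      ∑ k, T q n a k * star (T q n b k) = (1 : Matrix _ _ (SUq2 q)) a b := by
    rw [← T_coisometry, Matrix.mul_apply]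
    rfl
  rw [mem_S4]
  simp only [map_sum, map_mul, hv, hw, Finset.sum_mul_sum, Algebra.TensorProduct.tmul_mul_tmul]
  rw [Finset.sum_comm, TensorProduct.sum_tmul]
  refine Finset.sum_congr rfl fun a _ => ?_
  rw [Finset.sum_comm]
  simp only [← TensorProduct.tmul_sum, hT]
  rw [Finset.sum_eq_single a]
  · rw [Matrix.one_apply_eq]
  · intro b _ hb
    rw [Matrix.one_apply_ne hb.symm, TensorProduct.tmul_zero]
  · simp

lemma coaction_star_U (I : Fin n → Fin 4) (k : Fin (n + 1)) :
    coaction q (star (U q n I k)) = ∑ i, star (U q n I i) ⊗ₜ[ℂ] star (T q n i k) := by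
  rw [map_star, coaction_U_apply, star_sum]
  simp only [TensorProduct.star_tmul]

lemma U_mul_conjTranspose_mem (I J : Fin n → Fin 4) : (U q n * (U q n)ᴴ) I J ∈ S4 q :=
  sum_mul_mem_S4 (coaction_U_apply I) (coaction_star_U J)

variable (q n) in
/-- The projection `P^(n) = U^(n) U^(n)^*` over `O(S^4_q)`. -/
noncomputable def proj : Matrix (Fin n → Fin 4) (Fin n → Fin 4) (S4 q) :=
  Matrix.of fun I J => ⟨(U q n * (U q n)ᴴ) I J, U_mul_conjTranspose_mem I J⟩

lemma coe_proj (I J : Fin n → Fin 4) : (proj q n I J : S7 q) = (U q n * (U q n)ᴴ) I J := rfl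

variable (q n) in
lemma proj_isStarProjection : IsStarProjection (proj q n) where
  isIdempotentElem := by
    ext I J
    have h : U q n * (U q n)ᴴ * (U q n * (U q n)ᴴ) = U q n * (U q n)ᴴ := by
      rw [Matrix.mul_assoc, ← Matrix.mul_assoc _ (U q n), U_isometry, Matrix.one_mul]
    rw [coe_proj, ← h, Matrix.mul_apply, Matrix.mul_apply]
    push_cast
    rfl
  isSelfAdjoint := by
    ext I J
    have h : (U q n * (U q n)ᴴ)ᴴ = U q n * (U q n)ᴴ := by
      rw [Matrix.conjTranspose_mul, Matrix.conjTranspose_conjTranspose]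
    rw [coe_proj, ← h]
    rfl

lemma coe_proj_mulVec (v : (Fin n → Fin 4) → S4 q) (I : Fin n → Fin 4) :
    ((proj q n *ᵥ v) I : S7 q) = ((U q n * (U q n)ᴴ) *ᵥ fun J => (v J : S7 q)) I := by
  rw [Matrix.mulVec, Matrix.mulVec, dotProduct, dotProduct]
  push_cast
  rfl

variable (q n) in
/-- The coordinates of an element of `O(S^7_q) ⊗ V_n`. -/
noncomputable def coords : S7 q ⊗[ℂ] (Fin (n + 1) → ℂ) ≃ₗ[ℂ] (Fin (n + 1) → S7 q) :=
  TensorProduct.piScalarRight ℂ ℂ (S7 q) (Fin (n + 1))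

lemma coords_tmul (a : S7 q) (v : Fin (n + 1) → ℂ) (i : Fin (n + 1)) :
    coords q n (a ⊗ₜ v) i = v i • a := by
  simp [coords]

lemma piScalarRight_sum_single {M : Type} [AddCommGroup M] [Module ℂ M] (a : Fin (n + 1) → M) :
    TensorProduct.piScalarRight ℂ ℂ M (Fin (n + 1))
      (∑ i, a i ⊗ₜ[ℂ] Pi.single i (1 : ℂ)) = a := by
  ext j
  rw [map_sum, Finset.sum_apply, Finset.sum_eq_single j]
  · simp
  · intro i _ hi
    simp [hi.symm]
  · simp

lemma sum_coords (ξ : S7 q ⊗[ℂ] (Fin (n + 1) → ℂ)) :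
    ∑ i, coords q n ξ i ⊗ₜ[ℂ] Pi.single i (1 : ℂ) = ξ :=
  (coords q n).injective (piScalarRight_sum_single _)

lemma coords_smul (b : (S4 q)ᵐᵒᵖ) (ξ : S7 q ⊗[ℂ] (Fin (n + 1) → ℂ)) (i : Fin (n + 1)) :
    coords q n (b • ξ) i = coords q n ξ i * (b.unop : S7 q) := by
  induction ξ using TensorProduct.induction_on with
  | zero => simp
  | add y z hy hz => rw [smul_add, map_add, map_add, Pi.add_apply, hy, hz, Pi.add_apply, add_mul]
  | tmul a v => rw [op_smul_tmul, coords_tmul, coords_tmul, smul_mul_assoc]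

/-- Comparing coefficients of the basis vectors of `V_n` turns the cotensor condition into the
transformation law satisfied by the rows of `U`. -/
lemma mem_E_iff {ξ : S7 q ⊗[ℂ] (Fin (n + 1) → ℂ)} : ξ ∈ E q n ↔
    ∀ j, coaction q (coords q n ξ j) = ∑ i, coords q n ξ i ⊗ₜ[ℂ] T q n i j := by
  have h : ξ ∈ E q n ↔ TensorProduct.assoc ℂ _ _ _
      ((coaction q).toAlgHom.toLinearMap.rTensor (Fin (n + 1) → ℂ) ξ)
        = (coactionV q n).lTensor (S7 q) ξ := Iff.rfl
  have hV (i : Fin (n + 1)) : coactionV q n (Pi.single i (1 : ℂ)) =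
      ∑ j, T q n i j ⊗ₜ[ℂ] Pi.single j (1 : ℂ) := by
    rw [coactionV, ← Pi.basisFun_apply, Module.Basis.constr_basis]
  have hl : (coaction q).toAlgHom.toLinearMap.rTensor (Fin (n + 1) → ℂ) ξ =
      ∑ j, coaction q (coords q n ξ j) ⊗ₜ[ℂ] Pi.single j (1 : ℂ) := by
    conv_lhs => rw [← sum_coords ξ, map_sum]
    rfl
  have hr : (coactionV q n).lTensor (S7 q) ξ = TensorProduct.assoc ℂ _ _ _
      (∑ j, (∑ i, coords q n ξ i ⊗ₜ[ℂ] T q n i j) ⊗ₜ[ℂ] Pi.single j (1 : ℂ)) := by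
    conv_lhs => rw [← sum_coords ξ, map_sum]
    simp only [LinearMap.lTensor_tmul, hV, TensorProduct.tmul_sum, TensorProduct.sum_tmul, map_sum,
      TensorProduct.assoc_tmul]
    exact Finset.sum_comm
  rw [h, hl, hr, (TensorProduct.assoc ℂ _ _ _).injective.eq_iff]
  rw [← (TensorProduct.piScalarRight ℂ ℂ (S7 q ⊗[ℂ] SUq2 q) (Fin (n + 1))).injective.eq_iff,
    piScalarRight_sum_single, piScalarRight_sum_single, funext_iff]

lemma neg_c_pow_ne_zero (k : ℕ) : (-q.c) ^ k ≠ 0 := pow_ne_zero _ (neg_ne_zero.2 q.c_ne_zero)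

/-- The corepresentation `V_n` is equivalent to its conjugate. -/
lemma coaction_twist {ξ : Fin (n + 1) → S7 q}
    (h : ∀ j, coaction q (ξ j) = ∑ i, ξ i ⊗ₜ[ℂ] T q n i j) (k : Fin (n + 1)) :
    coaction q ((-q.c) ^ (k : ℕ) • ξ k.rev) =
      ∑ i : Fin (n + 1), ((-q.c) ^ (i : ℕ) • ξ i.rev) ⊗ₜ[ℂ] star (T q n i k) := by
  rw [map_smul, h, ← Equiv.sum_comp Fin.revPerm, Finset.smul_sum]
  refine Finset.sum_congr rfl fun i _ => ?_
  rw [TensorProduct.smul_tmul, star_T, TensorProduct.tmul_smul]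
  rfl

lemma coaction_untwist {w : Fin (n + 1) → S7 q}
    (h : ∀ j, coaction q (w j) = ∑ i, w i ⊗ₜ[ℂ] star (T q n i j)) (k : Fin (n + 1)) :
    coaction q (((-q.c) ^ (k.rev : ℕ))⁻¹ • w k.rev) =
      ∑ i : Fin (n + 1), (((-q.c) ^ (i.rev : ℕ))⁻¹ • w i.rev) ⊗ₜ[ℂ] T q n i k := by
  rw [map_smul, h, ← Equiv.sum_comp Fin.revPerm, Finset.smul_sum]
  refine Finset.sum_congr rfl fun i _ => ?_
  have hT := star_T (q := q) n i.rev k.rev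
  rw [Fin.rev_rev, Fin.rev_rev] at hT
  rw [Fin.revPerm_apply, TensorProduct.smul_tmul, ← TensorProduct.tmul_smul]
  congr 1
  rw [inv_smul_eq_iff₀ (neg_c_pow_ne_zero _), smul_comm, ← hT, smul_smul,
    inv_mul_cancel₀ (neg_c_pow_ne_zero _), one_smul]

/-- The column of coordinates of an element of `ℰ_n`, transforming with the adjoint of `T^(n)`. -/
noncomputable def twistedCoords (ξ : E q n) (k : Fin (n + 1)) : S7 q :=
  (-q.c) ^ (k : ℕ) • coords q n ξ k.rev

lemma U_mulVec_twistedCoords_mem (ξ : E q n) (I : Fin n → Fin 4) :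
    (U q n *ᵥ twistedCoords ξ) I ∈ S4 q :=
  sum_mul_mem_S4 (coaction_U_apply I) (coaction_twist (mem_E_iff.1 ξ.2))

lemma coaction_conjTranspose_mulVec (v : (Fin n → Fin 4) → S4 q) (k : Fin (n + 1)) :
    coaction q (((U q n)ᴴ *ᵥ fun J => (v J : S7 q)) k) =
      ∑ i, ((U q n)ᴴ *ᵥ fun J => (v J : S7 q)) i ⊗ₜ[ℂ] star (T q n i k) := by
  have hv (J : Fin n → Fin 4) : coaction q (v J : S7 q) = (v J : S7 q) ⊗ₜ 1 := (v J).2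
  simp only [Matrix.mulVec, dotProduct, Matrix.conjTranspose_apply, map_sum, map_mul,
    coaction_star_U, hv, Finset.sum_mul, Algebra.TensorProduct.tmul_mul_tmul, mul_one,
    TensorProduct.sum_tmul]
  exact Finset.sum_comm

variable (q n) in
/-- The map `ℰ_n → P^(n) O(S^4_q)^(4^n)` given by `U^(n)`. -/
noncomputable def toImage : E q n →ₗ[(S4 q)ᵐᵒᵖ] imageModule (proj q n) where
  toFun ξ := ⟨fun I => ⟨(U q n *ᵥ twistedCoords ξ) I, U_mulVec_twistedCoords_mem ξ I⟩,
    -- The vector is its own preimage, because `P U = U`.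
    fun I => ⟨(U q n *ᵥ twistedCoords ξ) I, U_mulVec_twistedCoords_mem ξ I⟩, by
      funext I
      apply Subtype.ext
      rw [coe_proj_mulVec]
      change ((U q n * (U q n)ᴴ) *ᵥ (U q n *ᵥ twistedCoords ξ)) I = _
      rw [Matrix.mulVec_mulVec, Matrix.mul_assoc, U_isometry, Matrix.mul_one]⟩
  map_add' ξ η := by
    apply Subtype.ext
    funext I
    apply Subtype.ext
    have h : twistedCoords (ξ + η) = twistedCoords ξ + twistedCoords η := by
      funext k
      simp [twistedCoords]
    change (U q n *ᵥ twistedCoords (ξ + η)) I =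
      (U q n *ᵥ twistedCoords ξ) I + (U q n *ᵥ twistedCoords η) I
    rw [h, Matrix.mulVec_add, Pi.add_apply]
  map_smul' b ξ := by
    apply Subtype.ext
    funext I
    apply Subtype.ext
    change (U q n *ᵥ twistedCoords (b • ξ)) I = (U q n *ᵥ twistedCoords ξ) I * (b.unop : S7 q)
    have h (k : Fin (n + 1)) : twistedCoords (b • ξ) k = twistedCoords ξ k * (b.unop : S7 q) := by
      rw [twistedCoords, twistedCoords, Submodule.coe_smul, coords_smul, smul_mul_assoc]
    simp only [Matrix.mulVec, dotProduct, h, Finset.sum_mul, mul_assoc]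

lemma coe_toImage (ξ : E q n) (I : Fin n → Fin 4) :
    ((toImage q n ξ : (Fin n → Fin 4) → S4 q) I : S7 q) = (U q n *ᵥ twistedCoords ξ) I := rfl

-- Multiplication by `U^*` recovers the twisted coordinates.
variable (q n) in
lemma toImage_injective : Function.Injective (toImage q n) := by
  intro ξ η h
  have h1 : U q n *ᵥ twistedCoords ξ = U q n *ᵥ twistedCoords η := by
    funext I
    rw [← coe_toImage, h, coe_toImage]
  have h2 := congrArg (fun v => (U q n)ᴴ *ᵥ v) h1
  simp only [Matrix.mulVec_mulVec, U_isometry, Matrix.one_mulVec] at h2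
  apply Subtype.ext
  apply (coords q n).injective
  funext k
  have h3 := congrFun h2 k.rev
  rw [twistedCoords, twistedCoords, Fin.rev_rev] at h3
  exact (smul_right_injective _ (neg_c_pow_ne_zero _)) h3

variable (q n) in
lemma toImage_surjective : Function.Surjective (toImage q n) := by
  rintro ⟨_, v, rfl⟩
  set w : Fin (n + 1) → S7 q := (U q n)ᴴ *ᵥ fun J => (v J : S7 q) with hw
  -- Since `P v = U (U^* v)`, the preimage is the element whose twisted coordinates are `U^* v`.
  set ξ : S7 q ⊗[ℂ] (Fin (n + 1) → ℂ) :=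
    (coords q n).symm fun k => ((-q.c) ^ (k.rev : ℕ))⁻¹ • w k.rev with hξ
  have hc (k : Fin (n + 1)) : coords q n ξ k = ((-q.c) ^ (k.rev : ℕ))⁻¹ • w k.rev := by
    rw [hξ, LinearEquiv.apply_symm_apply]
  have hmem : ξ ∈ E q n := by
    rw [mem_E_iff]
    simp only [hc]
    exact coaction_untwist (coaction_conjTranspose_mulVec v)
  refine ⟨⟨ξ, hmem⟩, ?_⟩
  apply Subtype.ext
  funext I
  apply Subtype.ext
  have ht : twistedCoords ⟨ξ, hmem⟩ = w := by
    funext k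
    rw [twistedCoords, hc, Fin.rev_rev, smul_smul, mul_inv_cancel₀ (neg_c_pow_ne_zero _), one_smul]
  rw [coe_toImage, ht, coe_proj_mulVec, hw, Matrix.mulVec_mulVec]

end Rows

end QuantumInstanton

theorem proposition5p6 (q : Par) (n : ℕ) (hn : 1 ≤ n) :
    (U q n)ᴴ * U q n = 1 ∧
    (U q n).map (coaction q) = dotTensor (U q n) (T q n) ∧
    ∃ P : Matrix (Fin n → Fin 4) (Fin n → Fin 4) (S4 q),
      P.map (fun b => (b : S7 q)) = U q n * (U q n)ᴴ ∧
      IsStarProjection P ∧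
      Nonempty (imageModule P ≃ₗ[(S4 q)ᵐᵒᵖ] E q n) :=
  ⟨U_isometry q n, coaction_U q n, proj q n, rfl, proj_isStarProjection q n,
    ⟨(LinearEquiv.ofBijective (toImage q n)
      ⟨toImage_injective q n, toImage_surjective q n⟩).symm⟩⟩
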